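/- Let $B$ be an operator algebra, i.e. a unital Banach algebra over $\mathbb R$ (for instance $n\times n$ matrices), let $A=C(\mathbb R,B)$ be the algebra of continuous $B$-valued functions, and let $P\{a\}(x)=\int_0^x a(y)\,dy$ be the indefinite Riemann integral. Extend $P$ coefficientwise to $A[[t]]$; with the filtration $A_n=t^nA[[t]]$ this is a complete filtered Rota--Baxter algebra of weight zero, i.e. $P(u)P(v)=P(uP(v))+P(P(u)v)$. Write $\mathrm{ad}\,u\,(v)=uv-vu$ and $b_n=B_n/n!$ with the Bernoulli numbers $B_n$ ($B_1=-\tfrac12$), so that $\frac{z}{e^z-1}=\sum_{n\ge0}b_nz^n$. For $u\in A_1=tA[[t]]$ let $\chi_0(u)$ be the limit of the weight zero BCH-recursion $c_0=u$, $c_{k+1}=\sum_{n\ge 0}b_n\,(\mathrm{ad}\,P(c_k))^n(u)$. Let $a\in A$. The parameter $t$ in $ta$ counts the number of factors $a$. (i) The recursion for $\chi_0(ta)$ converges in $A[[t]]$, $\chi_0(ta)\in A_1$, and $\chi_0(ta)$ is the unique $c\in A_1$ with $$c=\sum_{n\ge0}b_n\,(\mathrm{ad}\,P(c))^n(ta)=\frac{\mathrm{ad}\,P(c)}{e^{\mathrm{ad}\,P(c)}-1}(ta).$$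 (ii) Magnus' $\Omega$-expansion $\Omega[a]=\sum_{n>0}t^n\,\Omega^{(n)}[a]$ for the initial value problem $F'=taF$, $F(0)=1$ is $$\Omega[a](x)=P\big(\chi_0(ta)\big)(x).$$ That is, $P(\chi_0(ta))$ is the unique $\Omega\in A_1$ with $\Omega(0)=0$ such that $F=\exp(\Omega)$ satisfies $\frac{d}{dx}F=(ta)F$, $F(0)=1$ (coefficient by coefficient in $t$), and it is also the unique $\Omega\in A_1$ with $\Omega(0)=0$ that satisfies Magnus' recursive equation $$\frac{d}{dx}\Omega=\frac{\mathrm{ad}\,\Omega}{e^{\mathrm{ad}\,\Omega}-1}(ta).$$ (iii) At $t=1$: the initial value problem $F'(x)=a(x)F(x)$, $F(0)=1$ has a unique solution $F:\mathbb R\to B$, and $F(x)=\exp\big(\sum_{n}\Omega^{(n)}[a](x)\big)$ for every $x\in\mathbb R$ at which $\sum_n\Omega^{(n)}[a](x)$ converges absolutely. There is a $\delta>0$ such that for $|x|<\delta$ this series and the series $\chi_0(a)(x):=\sum_n\chi_0^{(n)}(x)$ of the coefficients of $\chi_0(ta)=\sum_n t^n\chi_0^{(n)}$ converge absolutely, $\chi_0(a)$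 is continuous on $(-\delta,\delta)$, and for $|x|<\delta$ $$\sum_n\Omega^{(n)}[a](x)=\int_0^x\chi_0(a)(y)\,dy,\qquad \chi_0(a)(x)=\sum_{n\ge0}b_n\Big(\mathrm{ad}\int_0^x\chi_0(a)(y)\,dy\Big)^{n}\big(a(x)\big).$$ -/

import Mathlib

namespace MagnusBCH

/-- A complete filtration `A = A₀ ⊇ A₁ ⊇ A₂ ⊇ ⋯` of an associative algebra `A`:
`Aₘ Aₙ ⊆ Aₘ₊ₙ` and `A ≅ lim A / Aₙ` (injectivity is `separated`, surjectivity is `complete`). -/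
structure CompleteFiltration (K A : Type*) [Field K] [Ring A] [Algebra K A] where
  filt : ℕ → Submodule K A
  filt_zero : filt 0 = ⊤
  antitone : Antitone filt
  mul_mem : ∀ {m n : ℕ} {x y : A}, x ∈ filt m → y ∈ filt n → x * y ∈ filt (m + n)
  separated : ∀ x : A, (∀ n, x ∈ filt n) → x = 0
  complete : ∀ u : ℕ → A, (∀ n, u (n + 1) - u n ∈ filt n) → ∃ l, ∀ n, l - u n ∈ filt n

namespace CompleteFiltration

variable {K A : Type*} [Field K] [Ring A] [Algebra K A] (𝓕 : CompleteFiltration K A)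

/-- Convergence of a sequence in the topology defined by the filtration. -/
def IsLimit (u : ℕ → A) (l : A) : Prop :=
  ∀ N, ∃ M, ∀ m, M ≤ m → l - u m ∈ 𝓕.filt N

/-- Convergence of a series in the topology defined by the filtration. -/
def IsSum (f : ℕ → A) (s : A) : Prop :=
  𝓕.IsLimit (fun m => ∑ i ∈ Finset.range m, f i) s

open Classical in
/-- The limit of a convergent sequence (`0` if the sequence does not converge). -/
noncomputable def lim (u : ℕ → A) : A :=
  if h : ∃ l, 𝓕.IsLimit u l then h.choose else 0

/-- The sum of a convergent series (`0` if the series does not converge). -/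
noncomputable def sum (f : ℕ → A) : A :=
  𝓕.lim fun m => ∑ i ∈ Finset.range m, f i

/-- `exp x = ∑ xⁿ / n!`, meant for `x ∈ A₁`. -/
noncomputable def exp (x : A) : A :=
  𝓕.sum fun n => ((n.factorial : K)⁻¹) • x ^ n

end CompleteFiltration

/-- A complete filtered Rota--Baxter algebra of weight zero: a complete filtered algebra with a
linear operator `P` that preserves the filtration and satisfies
`P(x) P(y) = P(x P(y)) + P(P(x) y)`. -/
structure ZeroRotaBaxter (K A : Type*) [Field K] [Ring A] [Algebra K A] extends
    CompleteFiltration K A where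
  P : A →ₗ[K] A
  P_mem : ∀ {n : ℕ} {x : A}, x ∈ filt n → P x ∈ filt n
  rotaBaxter : ∀ x y : A, P x * P y = P (x * P y) + P (P x * y)

/-- The coefficients `bₙ = Bₙ / n!` (with `B₁ = -1/2`) of `z / (e ^ z - 1) = ∑ bₙ zⁿ`. -/
noncomputable def bCoeff (K : Type*) [Field K] (n : ℕ) : K :=
  ((bernoulli n : ℚ) : K) / (n.factorial : K)

/-- The `n`-th term `bₙ (ad u)ⁿ (a)` of the series `(ad u / (e ^ {ad u} - 1)) (a)`. -/
noncomputable def adTerm (K : Type*) {A : Type*} [Field K] [Ring A] [Algebra K A]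
    (u a : A) (n : ℕ) : A :=
  bCoeff K n • (fun y : A => u * y - y * u)^[n] a

namespace ZeroRotaBaxter

variable {K A : Type*} [Field K] [Ring A] [Algebra K A] (R : ZeroRotaBaxter K A)

/-- The iterates of the weight zero BCH-recursion: `a` at stage `0`, and
`∑ bₙ (ad P(c))ⁿ (a)` after `c`. -/
noncomputable def chiIter (a : A) : ℕ → A
  | 0 => a
  | k + 1 => R.sum (adTerm K (R.P (chiIter a k)) a)

/-- The map `χ₀` of the weight zero BCH-recursion, meant for `a ∈ A₁`. -/
noncomputable def chi (a : A) : A :=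
  R.lim (R.chiIter a)

end ZeroRotaBaxter

/-! ### Operator-valued functions and the Riemann integral -/

section Functions

variable {B : Type*} [NormedRing B] [NormedAlgebra ℝ B]

/-- The indefinite Riemann integral `P{a}(x) = ∫₀ˣ a(y) dy` on continuous functions. -/
noncomputable def riemannP : C(ℝ, B) →ₗ[ℝ] C(ℝ, B) where
  toFun a :=
    ⟨fun x => ∫ y in (0 : ℝ)..x, a y,
      intervalIntegral.continuous_primitive (fun _ _ => a.continuous.intervalIntegrable _ _) 0⟩
  map_add' a b := by
    ext x
    exact intervalIntegral.integral_add (a.continuous.intervalIntegrable _ _)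
      (b.continuous.intervalIntegrable _ _)
  map_smul' r a := by
    ext x
    exact intervalIntegral.integral_smul r _

theorem riemannP_rotaBaxter [CompleteSpace B] (a b : C(ℝ, B)) :
    riemannP a * riemannP b = riemannP (a * riemannP b) + riemannP (riemannP a * b) := by
  have hd : ∀ (f : C(ℝ, B)) (x : ℝ), HasDerivAt (riemannP f) (f x) x := fun f x =>
    intervalIntegral.integral_hasDerivAt_right (f.continuous.intervalIntegrable _ _)
      f.continuous.aestronglyMeasurable.stronglyMeasurableAtFilter f.continuous.continuousAt
  have h0 : ∀ f : C(ℝ, B), riemannP f 0 = 0 := fun f => intervalIntegral.integral_same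
  rw [← map_add]
  ext x
  have h := intervalIntegral.integral_deriv_mul_eq_sub (a := 0) (b := x)
    (fun y _ => hd a y) (fun y _ => hd b y)
    (a.continuous.intervalIntegrable _ _) (b.continuous.intervalIntegrable _ _)
  rw [h0, h0, mul_zero, sub_zero] at h
  exact h.symm

end Functions

/-! ### Formal power series in a counting parameter -/

/-- The `t`-adic filtration `Aₙ = tⁿ S[[t]]` of `S[[t]]`. -/
def tAdic (K S : Type*) [Field K] [Ring S] [Algebra K S] :
    CompleteFiltration K (PowerSeries S) where
  filt n :=
    { carrier := {f | ∀ i, i < n → PowerSeries.coeff i f = 0}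
      add_mem' := fun hf hg i hi => by rw [map_add, hf i hi, hg i hi, add_zero]
      zero_mem' := fun i _ => map_zero _
      smul_mem' := fun c f hf i hi => by
        have : PowerSeries.coeff i (c • f) = c • PowerSeries.coeff i f := rfl
        rw [this, hf i hi, smul_zero] }
  filt_zero := by
    ext f
    exact ⟨fun _ => trivial, fun _ i hi => absurd hi (Nat.not_lt_zero i)⟩
  antitone := fun _ _ hmn _ hf i hi => hf i (lt_of_lt_of_le hi hmn)
  mul_mem := by
    intro m n x y hx hy i hi
    rw [PowerSeries.coeff_mul]
    refine Finset.sum_eq_zero fun p hp => ?_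
    have hp' := Finset.HasAntidiagonal.mem_antidiagonal.mp hp
    rcases lt_or_ge p.1 m with h | h
    · rw [hx _ h, zero_mul]
    · rw [hy _ (by omega), mul_zero]
  separated := fun x hx => PowerSeries.ext fun n => by
    rw [hx (n + 1) n (Nat.lt_succ_self n), map_zero]
  complete := by
    intro u hu
    refine ⟨PowerSeries.mk fun i => PowerSeries.coeff i (u (i + 1)), fun n i hi => ?_⟩
    have key : ∀ k, PowerSeries.coeff i (u (i + 1 + k)) = PowerSeries.coeff i (u (i + 1)) := by
      intro k
      induction k with
      | zero => rfl
      | succ k ih =>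
        have h := hu (i + 1 + k) i (by omega)
        rw [map_sub, sub_eq_zero] at h
        rw [← ih]
        exact h
    have h := key (n - (i + 1))
    rw [show i + 1 + (n - (i + 1)) = n by omega] at h
    rw [map_sub, PowerSeries.coeff_mk, h, sub_self]

section Formal

variable {B : Type*} [NormedRing B] [NormedAlgebra ℝ B]

/-- The Riemann integral on `C(ℝ, B)[[t]]`, acting on each coefficient. -/
noncomputable def formalP : PowerSeries C(ℝ, B) →ₗ[ℝ] PowerSeries C(ℝ, B) where
  toFun f := PowerSeries.mk fun n => riemannP (PowerSeries.coeff n f)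
  map_add' f g := by
    ext1 n
    simp only [PowerSeries.coeff_mk, map_add]
  map_smul' r f := by
    ext1 n
    have h : ∀ g : PowerSeries C(ℝ, B),
        PowerSeries.coeff n (r • g) = r • PowerSeries.coeff n g := fun _ => rfl
    simp only [PowerSeries.coeff_mk, h, map_smul, RingHom.id_apply]

theorem coeff_formalP (n : ℕ) (f : PowerSeries C(ℝ, B)) :
    PowerSeries.coeff n (formalP f) = riemannP (PowerSeries.coeff n f) :=
  PowerSeries.coeff_mk n fun i => riemannP (PowerSeries.coeff i f)

/-- The complete filtered Rota--Baxter algebra `C(ℝ, B)[[t]]` with the Riemann integral. -/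
noncomputable def magnusRB (B : Type*) [NormedRing B] [NormedAlgebra ℝ B] [CompleteSpace B] :
    ZeroRotaBaxter ℝ (PowerSeries C(ℝ, B)) where
  toCompleteFiltration := tAdic ℝ C(ℝ, B)
  P := formalP
  P_mem := fun {n x} hx i hi => by
    rw [coeff_formalP, hx i hi, map_zero]
  rotaBaxter := fun x y => by
    ext1 n
    simp only [map_add, coeff_formalP, PowerSeries.coeff_mul, map_sum]
    rw [← Finset.sum_add_distrib]
    exact Finset.sum_congr rfl fun p _ => riemannP_rotaBaxter _ _

/-- The formal series `t a`; the power of `t` counts the number of factors `a`. -/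
noncomputable def tMul (a : C(ℝ, B)) : PowerSeries C(ℝ, B) :=
  PowerSeries.monomial 1 a

/-- The `n`-th term `f⁽ⁿ⁾(x)` of the expansion `f = ∑ tⁿ f⁽ⁿ⁾`. -/
noncomputable def term (f : PowerSeries C(ℝ, B)) (n : ℕ) (x : ℝ) : B :=
  (PowerSeries.coeff n f : C(ℝ, B)) x

/-- The value `∑ f⁽ⁿ⁾(x)` of the expansion at `t = 1`. -/
noncomputable def value (f : PowerSeries C(ℝ, B)) (x : ℝ) : B :=
  ∑' n, term f n x

/-- The weight zero BCH-recursion map `χ₀`, for the Riemann integral, at `t a`. -/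
noncomputable def chiZero [CompleteSpace B] (a : C(ℝ, B)) : PowerSeries C(ℝ, B) :=
  (magnusRB B).chi (tMul a)

/-- The value `f(x) ∈ B[[t]]` at `x ∈ ℝ` of `f ∈ C(ℝ, B)[[t]]`. -/
noncomputable def evalAt (x : ℝ) (f : PowerSeries C(ℝ, B)) : PowerSeries B :=
  PowerSeries.mk fun n => term f n x

/-- `df/dx = g` in `C(ℝ, B)[[t]]`, coefficient by coefficient. -/
def HasFormalDeriv (f g : PowerSeries C(ℝ, B)) : Prop :=
  ∀ (n : ℕ) (x : ℝ), HasDerivAt (term f n) (term g n x) x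

/-- `Ω = ∑_{n > 0} tⁿ Ω⁽ⁿ⁾` with `Ω(0) = 0` is an exponential solution of the initial value
problem: `F = exp Ω` satisfies `F' = (t a) F`, `F(0) = 1`. -/
structure IsMagnusExponent (a : C(ℝ, B)) (Ω : PowerSeries C(ℝ, B)) : Prop where
  mem : Ω ∈ (tAdic ℝ C(ℝ, B)).filt 1
  initial : evalAt 0 Ω = 0
  deriv_exp : HasFormalDeriv ((tAdic ℝ C(ℝ, B)).exp Ω) (tMul a * (tAdic ℝ C(ℝ, B)).exp Ω)
  initial_exp : evalAt 0 ((tAdic ℝ C(ℝ, B)).exp Ω) = 1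

/-- `Ω = ∑_{n > 0} tⁿ Ω⁽ⁿ⁾` with `Ω(0) = 0` satisfies Magnus' recursive equation
`dΩ/dx = (ad Ω / (e ^ {ad Ω} - 1)) (t a)`. -/
structure SatisfiesMagnusRecursion (a : C(ℝ, B)) (Ω : PowerSeries C(ℝ, B)) : Prop where
  mem : Ω ∈ (tAdic ℝ C(ℝ, B)).filt 1
  initial : evalAt 0 Ω = 0
  deriv : ∃ D, (tAdic ℝ C(ℝ, B)).IsSum (adTerm ℝ Ω (tMul a)) D ∧ HasFormalDeriv Ω D

/-- `F' = a F` on `ℝ`, `F(0) = 1`. -/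
structure SolvesIVP (a : C(ℝ, B)) (F : ℝ → B) : Prop where
  deriv : ∀ x, HasDerivAt F (a x * F x) x
  initial : F 0 = 1

end Formal

end MagnusBCH

/-! The map c ↦ ∑ bₙ (ad P(c))ⁿ(ta) on A₁ is a contraction for the t-adic filtration: since ta ∈ A₁
and P preserves the filtration, arguments that agree modulo tᴺ have images that agree modulo tᴺ⁺¹
(`isSum_adTerm_sub_mem`). This gives convergence of the recursion and the unique fixed point χ₀(ta).

Put Ω = P(χ₀(ta)), so Ω' = χ₀(ta). The Bernoulli recursion inverts ad Ω/(e^{ad Ω} - 1) and turns the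
fixed-point equation into ((e^{ad Ω} - 1)/ad Ω)(Ω') = ta (`isSum_of_isSum_adTerm`), while the
noncommutative Leibniz rule gives (exp Ω)' = ((e^{ad Ω} - 1)/ad Ω)(Ω') exp Ω (`isSum_mul_exp`).
Hence exp Ω solves the formal initial value problem. That problem determines its solution
coefficient by coefficient, and exp is injective on A₁ (`exp_injOn`), so Ω is the only exponent.
Solutions of Magnus' equation are P of fixed points.

At t = 1, the coefficients of exp Ω are iterated integrals bounded by ‖1‖(M|x|)ⁿ/n!, so their sum
converges everywhere and solves the actual problem. Summing coefficients is multiplicative on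
absolutely summable series, so this sum is exp of the Magnus sum wherever the latter converges
absolutely (`coeffSum_exp`). Near 0, |bₙ| ≤ 1 bounds the ad-series by a geometric one, and on a
small interval the recursion stays in a fixed ℓ¹-ball (`ellOne_restrictHom_chiZero_le`). -/

namespace MagnusBCH

/-! ### Uniqueness of limits in a complete filtration. -/

namespace CompleteFiltration

variable {K A : Type*} [Field K] [Ring A] [Algebra K A] {𝓕 : CompleteFiltration K A}

theorem IsLimit.unique {u : ℕ → A} {l l' : A} (h : 𝓕.IsLimit u l) (h' : 𝓕.IsLimit u l') :
    l = l' := by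
  refine sub_eq_zero.mp (𝓕.separated _ fun N => ?_)
  obtain ⟨M, hM⟩ := h N
  obtain ⟨M', hM'⟩ := h' N
  have := (𝓕.filt N).sub_mem (hM (max M M') (le_max_left _ _)) (hM' (max M M') (le_max_right _ _))
  simpa using this

theorem IsLimit.lim_eq {u : ℕ → A} {l : A} (h : 𝓕.IsLimit u l) : 𝓕.lim u = l := by
  have hex : ∃ l, 𝓕.IsLimit u l := ⟨l, h⟩
  rw [lim, dif_pos hex]
  exact hex.choose_spec.unique h

theorem IsSum.sum_eq {f : ℕ → A} {s : A} (h : 𝓕.IsSum f s) : 𝓕.sum f = s :=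
  IsLimit.lim_eq h

end CompleteFiltration

/-! ### Series in the t-adic filtration, and the exponential on A₁. -/

section TAdic

variable {K S : Type*} [Field K] [Ring S] [Algebra K S]

theorem coeff_scalar_smul (n : ℕ) (r : K) (f : PowerSeries S) :
    PowerSeries.coeff n (r • f) = r • PowerSeries.coeff n f := rfl

theorem sum_range_coeff_eq {f : ℕ → PowerSeries S} (hf : ∀ n, f n ∈ (tAdic K S).filt n)
    {i m : ℕ} (him : i < m) :
    ∑ n ∈ Finset.range m, PowerSeries.coeff i (f n) =
      ∑ n ∈ Finset.range (i + 1), PowerSeries.coeff i (f n) := by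
  symm
  refine Finset.sum_subset (Finset.range_mono him) fun n _ hn => hf n i ?_
  simpa using hn

/-- Since the n-th term is divisible by tⁿ, the i-th coefficient only sees the terms n ≤ i; t-adic
sums thus become finite sums. -/
theorem isSum_tAdic_iff {f : ℕ → PowerSeries S} (hf : ∀ n, f n ∈ (tAdic K S).filt n)
    {s : PowerSeries S} : (tAdic K S).IsSum f s ↔ ∀ i, PowerSeries.coeff i s =
      ∑ n ∈ Finset.range (i + 1), PowerSeries.coeff i (f n) := by
  constructor
  · intro h i
    obtain ⟨M, hM⟩ := h (i + 1)
    have := hM (max M (i + 1)) (le_max_left _ _) i (Nat.lt_succ_self i)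
    rw [map_sub, map_sum, sub_eq_zero] at this
    rw [this, sum_range_coeff_eq hf (lt_of_lt_of_le (Nat.lt_succ_self i) (le_max_right _ _))]
  · intro h N
    refine ⟨N, fun m hm i hi => ?_⟩
    rw [map_sub, map_sum, h i, sum_range_coeff_eq hf (lt_of_lt_of_le hi hm), sub_self]

theorem exists_isSum_tAdic {f : ℕ → PowerSeries S} (hf : ∀ n, f n ∈ (tAdic K S).filt n) :
    ∃ s, (tAdic K S).IsSum f s :=
  ⟨PowerSeries.mk fun i => ∑ n ∈ Finset.range (i + 1), PowerSeries.coeff i (f n),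
    (isSum_tAdic_iff hf).2 fun _ => PowerSeries.coeff_mk _ _⟩

theorem mem_of_isSum {f : ℕ → PowerSeries S} (hf : ∀ n, f n ∈ (tAdic K S).filt n) {m : ℕ}
    (hm : ∀ n, f n ∈ (tAdic K S).filt m) {s : PowerSeries S} (h : (tAdic K S).IsSum f s) :
    s ∈ (tAdic K S).filt m := fun i hi => by
  rw [(isSum_tAdic_iff hf).1 h i]
  exact Finset.sum_eq_zero fun n _ => hm n i hi

/-- Summing a double series along the antidiagonals. -/
theorem isSum_antidiagonal {f : ℕ → ℕ → PowerSeries S}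
    (hf : ∀ p q, f p q ∈ (tAdic K S).filt (p + q)) {r : ℕ → PowerSeries S}
    (hr : ∀ p, r p ∈ (tAdic K S).filt p)
    (hfr : ∀ p, (tAdic K S).IsSum (f p) (r p)) {s : PowerSeries S}
    (hs : (tAdic K S).IsSum r s) :
    (tAdic K S).IsSum (fun n => ∑ p ∈ Finset.range (n + 1), f p (n - p)) s := by
  have hmem : ∀ n, ∑ p ∈ Finset.range (n + 1), f p (n - p) ∈ (tAdic K S).filt n := fun n =>
    Submodule.sum_mem _ fun p hp => by
      have h := hf p (n - p)
      rwa [Nat.add_sub_cancel' (Nat.lt_succ_iff.mp (Finset.mem_range.mp hp))] at h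
  refine (isSum_tAdic_iff hmem).2 fun i => ?_
  simp only [map_sum]
  rw [Finset.sum_range_diag_flip (i + 1) fun p q => PowerSeries.coeff i (f p q),
    (isSum_tAdic_iff hr).1 hs i]
  refine Finset.sum_congr rfl fun p _ => ?_
  have hfp : ∀ q, f p q ∈ (tAdic K S).filt q := fun q =>
    (tAdic K S).antitone (Nat.le_add_left q p) (hf p q)
  rw [(isSum_tAdic_iff hfp).1 (hfr p) i]
  symm
  refine Finset.sum_subset (Finset.range_mono (Nat.sub_le _ _)) fun q _ hq => hf p q i ?_
  have := Finset.mem_range.not.mp hq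
  omega

theorem isSum_mul_right {f : ℕ → PowerSeries S} {s : PowerSeries S} (h : (tAdic K S).IsSum f s)
    (x : PowerSeries S) : (tAdic K S).IsSum (fun n => f n * x) (s * x) := fun N => by
  obtain ⟨M, hM⟩ := h N
  refine ⟨M, fun m hm => ?_⟩
  have := (tAdic K S).mul_mem (n := 0) (hM m hm) (y := x) (fun i hi => absurd hi (by omega))
  rwa [sub_mul, Finset.sum_mul] at this

theorem isSum_mul_left {f : ℕ → PowerSeries S} {s : PowerSeries S} (h : (tAdic K S).IsSum f s)
    (x : PowerSeries S) : (tAdic K S).IsSum (fun n => x * f n) (x * s) := fun N => by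
  obtain ⟨M, hM⟩ := h N
  refine ⟨M, fun m hm => ?_⟩
  have := (tAdic K S).mul_mem (m := 0) (x := x) (fun i hi => absurd hi (by omega)) (hM m hm)
  rwa [mul_sub, Finset.mul_sum, zero_add] at this

theorem isSum_smul {f : ℕ → PowerSeries S} {s : PowerSeries S} (h : (tAdic K S).IsSum f s)
    (r : K) : (tAdic K S).IsSum (fun n => r • f n) (r • s) := fun N => by
  obtain ⟨M, hM⟩ := h N
  refine ⟨M, fun m hm => ?_⟩
  have := ((tAdic K S).filt N).smul_mem r (hM m hm)
  rwa [smul_sub, Finset.smul_sum] at this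

theorem pow_mem_tAdic {u : PowerSeries S} (hu : u ∈ (tAdic K S).filt 1) (n : ℕ) :
    u ^ n ∈ (tAdic K S).filt n := by
  induction n with
  | zero => exact fun i hi => absurd hi (by omega)
  | succ n ih => rw [pow_succ]; exact (tAdic K S).mul_mem ih hu

theorem iterate_commutator_mem {u w : PowerSeries S} (hu : u ∈ (tAdic K S).filt 1) {m : ℕ}
    (hw : w ∈ (tAdic K S).filt m) (n : ℕ) :
    (fun y : PowerSeries S => u * y - y * u)^[n] w ∈ (tAdic K S).filt (m + n) := by
  induction n with
  | zero => exact hw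
  | succ n ih =>
    rw [Function.iterate_succ_apply']
    refine Submodule.sub_mem _ ?_ ?_
    · have := (tAdic K S).mul_mem hu ih
      rwa [show 1 + (m + n) = m + (n + 1) by omega] at this
    · exact (tAdic K S).mul_mem (m := m + n) ih hu

theorem adTerm_mem {u w : PowerSeries S} (hu : u ∈ (tAdic K S).filt 1) {m : ℕ}
    (hw : w ∈ (tAdic K S).filt m) (n : ℕ) : adTerm K u w n ∈ (tAdic K S).filt (m + n) :=
  Submodule.smul_mem _ _ (iterate_commutator_mem hu hw n)

theorem adTerm_mem_right {u w : PowerSeries S} (hu : u ∈ (tAdic K S).filt 1) (n : ℕ) :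
    adTerm K u w n ∈ (tAdic K S).filt n := by
  simpa using adTerm_mem (m := 0) hu (fun i hi => absurd hi (by omega)) n

/-- The extra power of t comes from w ∈ A₁: changing u by an element of tᴺ changes each commutator
by that element times something in A₁. -/
theorem iterate_commutator_sub_mem {u u' w : PowerSeries S} (hu : u ∈ (tAdic K S).filt 1)
    (hu' : u' ∈ (tAdic K S).filt 1) (hw : w ∈ (tAdic K S).filt 1) {N : ℕ}
    (huu : u - u' ∈ (tAdic K S).filt N) (n : ℕ) :
    (fun y : PowerSeries S => u * y - y * u)^[n] w -
      (fun y : PowerSeries S => u' * y - y * u')^[n] w ∈ (tAdic K S).filt (N + 1) := by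
  induction n with
  | zero => simp
  | succ n ih =>
    rw [Function.iterate_succ_apply', Function.iterate_succ_apply']
    have hx := (tAdic K S).antitone (Nat.le_add_right 1 n) (iterate_commutator_mem hu hw n)
    generalize (fun y : PowerSeries S => u * y - y * u)^[n] w = x at *
    generalize (fun y : PowerSeries S => u' * y - y * u')^[n] w = x' at *
    have e : u * x - x * u - (u' * x' - x' * u') =
        ((u - u') * x - x * (u - u')) + (u' * (x - x') - (x - x') * u') := by noncomm_ring
    rw [e]
    refine Submodule.add_mem _ (Submodule.sub_mem _ ((tAdic K S).mul_mem huu hx) ?_)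
      (Submodule.sub_mem _ ?_ ?_)
    · rw [add_comm]; exact (tAdic K S).mul_mem hx huu
    · exact (tAdic K S).antitone (by omega) ((tAdic K S).mul_mem hu' ih)
    · exact (tAdic K S).antitone (by omega) ((tAdic K S).mul_mem ih hu')

theorem isSum_adTerm_sub_mem {u u' w s s' : PowerSeries S} (hu : u ∈ (tAdic K S).filt 1)
    (hu' : u' ∈ (tAdic K S).filt 1) (hw : w ∈ (tAdic K S).filt 1) {N : ℕ}
    (huu : u - u' ∈ (tAdic K S).filt N) (hs : (tAdic K S).IsSum (adTerm K u w) s)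
    (hs' : (tAdic K S).IsSum (adTerm K u' w) s') : s - s' ∈ (tAdic K S).filt (N + 1) := by
  intro i hi
  rw [map_sub, (isSum_tAdic_iff (adTerm_mem_right hu)).1 hs i,
    (isSum_tAdic_iff (adTerm_mem_right hu')).1 hs' i, ← Finset.sum_sub_distrib]
  refine Finset.sum_eq_zero fun n _ => ?_
  rw [← map_sub]
  have := Submodule.smul_mem _ (bCoeff K n) (iterate_commutator_sub_mem hu hu' hw huu n)
  rw [smul_sub] at this
  exact this i hi

theorem exp_term_mem {u : PowerSeries S} (hu : u ∈ (tAdic K S).filt 1) (n : ℕ) :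
    ((n.factorial : K)⁻¹) • u ^ n ∈ (tAdic K S).filt n :=
  Submodule.smul_mem _ _ (pow_mem_tAdic hu n)

theorem isSum_exp {u : PowerSeries S} (hu : u ∈ (tAdic K S).filt 1) :
    (tAdic K S).IsSum (fun n => ((n.factorial : K)⁻¹) • u ^ n) ((tAdic K S).exp u) := by
  obtain ⟨s, hs⟩ := exists_isSum_tAdic (exp_term_mem hu)
  rw [CompleteFiltration.exp, hs.sum_eq]
  exact hs

theorem pow_sub_pow_mem {u u' : PowerSeries S} (hu : u ∈ (tAdic K S).filt 1)
    (hu' : u' ∈ (tAdic K S).filt 1) {N : ℕ} (huu : u - u' ∈ (tAdic K S).filt N) (n : ℕ) :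
    u ^ (n + 1) - u' ^ (n + 1) ∈ (tAdic K S).filt (N + n) := by
  induction n with
  | zero => simpa using huu
  | succ n ih =>
    have e : u ^ (n + 1 + 1) - u' ^ (n + 1 + 1) =
        (u ^ (n + 1) - u' ^ (n + 1)) * u + u' ^ (n + 1) * (u - u') := by
      rw [pow_succ u (n + 1), pow_succ u' (n + 1)]; noncomm_ring
    rw [e]
    refine Submodule.add_mem _ ((tAdic K S).mul_mem (m := N + n) ih hu) ?_
    rw [add_comm]
    exact (tAdic K S).mul_mem (pow_mem_tAdic hu' (n + 1)) huu

/-- The linear term dominates: if u - u' ∈ tᴺ, then uⁿ - u'ⁿ ∈ tᴺ⁺¹ for n ≥ 2, so equality of the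
exponentials forces u - u' ∈ tᴺ⁺¹. -/
theorem exp_injOn [CharZero K] : Set.InjOn (tAdic K S).exp ((tAdic K S).filt 1) := by
  intro u hu u' hu' h
  refine sub_eq_zero.mp ((tAdic K S).separated _ fun N => ?_)
  induction N with
  | zero => exact fun i hi => absurd hi (by omega)
  | succ N ih =>
    intro i hi
    have h1 := (isSum_tAdic_iff (exp_term_mem hu)).1 (isSum_exp hu) i
    have h2 := (isSum_tAdic_iff (exp_term_mem hu')).1 (isSum_exp hu') i
    rw [h, h2, ← sub_eq_zero, ← Finset.sum_sub_distrib] at h1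
    -- The range n ≤ i contains the linear term n = 1 only for i > 0; the constant coefficients
    -- vanish anyway.
    rcases Nat.eq_zero_or_pos i with rfl | hpos
    · rw [map_sub, hu 0 one_pos, hu' 0 one_pos, sub_zero]
    rw [Finset.sum_eq_single 1] at h1
    · rw [map_sub, ← neg_eq_zero, neg_sub]
      simpa using h1
    · intro n _ hn
      rw [← map_sub, ← smul_sub]
      rcases n with _ | n
      · simp
      · have := Submodule.smul_mem _ (((n + 1).factorial : K)⁻¹) (pow_sub_pow_mem hu hu' ih n)
        rw [← neg_sub, smul_neg, map_neg, neg_eq_zero]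
        exact this i (by omega)
    · intro h; exact absurd (Finset.mem_range.mpr (by omega)) h

/-- `∑ₚ C(m+1, p+1) Dᵖ R^(m-p) = ∑ᵢ (D+R)ⁱ R^(m-i)` for commuting `D` and `R`. -/
theorem sum_choose_mul_pow_eq {T : Type*} [Ring T] {D R : T} (h : Commute D R) (m : ℕ) :
    ∑ p ∈ Finset.range (m + 1), ((m + 1).choose (p + 1) : T) * (D ^ p * R ^ (m - p)) =
      ∑ i ∈ Finset.range (m + 1), (D + R) ^ i * R ^ (m - i) := by
  -- Both sides are formally ((D+R)^(m+1) - R^(m+1))/D, but D need not be invertible. Going from m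
  -- to m+1 multiplies by R and adds (D+R)^(m+1), which Pascal's rule matches on the left.
  induction m with
  | zero => simp
  | succ m ih =>
    have hR : ∀ f : ℕ → T, (∑ p ∈ Finset.range (m + 1), f p * R ^ (m - p)) * R =
        ∑ p ∈ Finset.range (m + 1), f p * R ^ (m + 1 - p) := fun f => by
      rw [Finset.sum_mul]
      refine Finset.sum_congr rfl fun p hp => ?_
      rw [mul_assoc, ← pow_succ, Nat.succ_sub (Nat.lt_succ_iff.mp (Finset.mem_range.mp hp))]
    rw [Finset.sum_range_succ (fun i => (D + R) ^ i * R ^ (m + 1 - i)), ← hR, ← ih]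
    simp only [← mul_assoc]
    rw [hR, h.add_pow, Nat.sub_self, pow_zero, mul_one]
    rw [Finset.sum_range_succ, Finset.sum_range_succ _ (m + 1), ← add_assoc,
      ← Finset.sum_add_distrib]
    congr 1
    · refine Finset.sum_congr rfl fun p _ => ?_
      have e : D ^ p * R ^ (m + 1 - p) * ((m + 1).choose p : T) =
        ((m + 1).choose p : T) * D ^ p * R ^ (m + 1 - p) := by
        rw [← (Nat.cast_commute _ _).eq, mul_assoc]
      rw [e, ← add_mul, ← add_mul, Nat.choose_succ_succ (m + 1) p]
      push_cast
      rw [add_comm]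
    · simp

end TAdic

/-! ### Inverting ad u/(e^{ad u} - 1), and the derivative of exp. -/

section TAdic

variable {K S : Type*} [Field K] [Ring S] [Algebra K S]

/-- This is the coefficient of zⁿ in ((e^z - 1)/z) · (z/(e^z - 1)) = 1, obtained from
`sum_bernoulli` by dividing by (n+1)!. -/
theorem sum_bCoeff_mul_inv_factorial (K : Type*) [Field K] [CharZero K] (n : ℕ) :
    ∑ j ∈ Finset.range (n + 1), (((j + 1).factorial : K)⁻¹) * bCoeff K (n - j) =
      if n = 0 then 1 else 0 := by
  have h := sum_bernoulli (n + 1)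
  rw [← Finset.sum_range_reflect] at h
  have h' := congrArg (fun q : ℚ => (q : K) / ((n + 1).factorial : K)) h
  simp only [Rat.cast_sum, Finset.sum_div] at h'
  rw [Finset.sum_congr rfl (g := fun j => (((j + 1).factorial : K)⁻¹) * bCoeff K (n - j))] at h'
  · rw [h']
    rcases n with _ | n <;> simp
  · intro j hj
    have hj' : j ≤ n := Nat.lt_succ_iff.mp (Finset.mem_range.mp hj)
    rw [show n + 1 - 1 - j = n - j by omega, bCoeff, Rat.cast_mul, Rat.cast_natCast,
      Nat.cast_choose K (show n - j ≤ n + 1 by omega), show n + 1 - (n - j) = j + 1 by omega]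
    have := Nat.cast_ne_zero (R := K).2 (Nat.factorial_ne_zero (n + 1))
    have := Nat.cast_ne_zero (R := K).2 (Nat.factorial_ne_zero (n - j))
    have := Nat.cast_ne_zero (R := K).2 (Nat.factorial_ne_zero (j + 1))
    field_simp

/-- The commutator `y ↦ u y - y u`. -/
def commutator (K : Type*) {A : Type*} [Field K] [Ring A] [Algebra K A] (u : A) : A →ₗ[K] A :=
  LinearMap.mulLeft K u - LinearMap.mulRight K u

theorem commutator_pow_apply {A : Type*} [Ring A] [Algebra K A] (u w : A) (n : ℕ) :
    (commutator K u ^ n) w = (fun y : A => u * y - y * u)^[n] w := by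
  rw [Module.End.pow_apply]; rfl

theorem isSum_sub {f g : ℕ → PowerSeries S} {s s' : PowerSeries S} (h : (tAdic K S).IsSum f s)
    (h' : (tAdic K S).IsSum g s') : (tAdic K S).IsSum (fun n => f n - g n) (s - s') := fun N => by
  obtain ⟨M, hM⟩ := h N
  obtain ⟨M', hM'⟩ := h' N
  refine ⟨max M M', fun m hm => ?_⟩
  have := Submodule.sub_mem _ (hM m ((le_max_left _ _).trans hm))
    (hM' m ((le_max_right _ _).trans hm))
  rwa [sub_sub_sub_comm, ← Finset.sum_sub_distrib] at this

theorem isSum_commutator_pow {f : ℕ → PowerSeries S} {s : PowerSeries S}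
    (h : (tAdic K S).IsSum f s) (u : PowerSeries S) (j : ℕ) :
    (tAdic K S).IsSum (fun n => (commutator K u ^ j) (f n)) ((commutator K u ^ j) s) := by
  induction j with
  | zero => simpa using h
  | succ j ih =>
    simp only [pow_succ', Module.End.mul_apply]
    exact isSum_sub (isSum_mul_left ih u) (isSum_mul_right ih u)

theorem commutator_pow_mem {u w : PowerSeries S} (hu : u ∈ (tAdic K S).filt 1) {m : ℕ}
    (hw : w ∈ (tAdic K S).filt m) (n : ℕ) :
    (commutator K u ^ n) w ∈ (tAdic K S).filt (n + m) := by
  rw [commutator_pow_apply, add_comm]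
  exact iterate_commutator_mem hu hw n

theorem mem_tAdic_zero (f : PowerSeries S) : f ∈ (tAdic K S).filt 0 :=
  fun _ hi => absurd hi (Nat.not_lt_zero _)

/-- `(e^{ad u} - 1) / ad u` inverts `ad u / (e^{ad u} - 1)`. -/
theorem isSum_of_isSum_adTerm [CharZero K] {u w c : PowerSeries S}
    (hu : u ∈ (tAdic K S).filt 1) (hc : (tAdic K S).IsSum (adTerm K u w) c) :
    (tAdic K S).IsSum (fun j => (((j + 1).factorial : K)⁻¹) • (commutator K u ^ j) c) w := by
  have hmem : ∀ j, (((j + 1).factorial : K)⁻¹) • (commutator K u ^ j) c ∈ (tAdic K S).filt j :=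
    fun j => Submodule.smul_mem _ _ (commutator_pow_mem hu (mem_tAdic_zero c) j)
  obtain ⟨w', hw'⟩ := exists_isSum_tAdic hmem
  have h := isSum_antidiagonal
    (f := fun j k => (((j + 1).factorial : K)⁻¹) • (commutator K u ^ j) (adTerm K u w k))
    (fun j k => Submodule.smul_mem _ _ (commutator_pow_mem hu (adTerm_mem_right hu k) j)) hmem
    (fun j => isSum_smul (isSum_commutator_pow hc u j) _) hw'
  -- Collected by the total power of ad u, the double series has the coefficients of the constant
  -- series 1.
  have e : (fun n => ∑ j ∈ Finset.range (n + 1),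
      (((j + 1).factorial : K)⁻¹) • (commutator K u ^ j) (adTerm K u w (n - j))) =
      fun n => (if n = 0 then (1 : K) else 0) • (commutator K u ^ n) w := by
    funext n
    rw [← sum_bCoeff_mul_inv_factorial, Finset.sum_smul]
    refine Finset.sum_congr rfl fun j hj => ?_
    rw [adTerm, ← commutator_pow_apply (K := K), map_smul, ← Module.End.mul_apply, ← pow_add,
      Nat.add_sub_cancel' (Nat.lt_succ_iff.mp (Finset.mem_range.mp hj)), smul_smul]
  rw [e] at h
  have hw : (tAdic K S).IsSum
      (fun n => (if n = 0 then (1 : K) else 0) • (commutator K u ^ n) w) w := by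
    refine fun N => ⟨1, fun m hm => ?_⟩
    beta_reduce
    rw [Finset.sum_eq_single 0]
    · simp
    · intro n _ hn; simp [hn]
    · intro h; exact absurd (Finset.mem_range.mpr (by omega)) h
  rw [← CompleteFiltration.IsLimit.unique h hw]
  exact hw'

/-- The derivative of the exponential, in terms of `(e^{ad u} - 1) / ad u`. -/
theorem isSum_mul_exp [CharZero K] {u w c : PowerSeries S} (hu : u ∈ (tAdic K S).filt 1)
    (hw : (tAdic K S).IsSum (fun j => (((j + 1).factorial : K)⁻¹) • (commutator K u ^ j) c) w) :
    (tAdic K S).IsSum (fun m => (((m + 1).factorial : K)⁻¹) •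
      ∑ i ∈ Finset.range (m + 1), u ^ i * c * u ^ (m - i)) (w * (tAdic K S).exp u) := by
  have hmem : ∀ j, (((j + 1).factorial : K)⁻¹) • (commutator K u ^ j) c ∈ (tAdic K S).filt j :=
    fun j => Submodule.smul_mem _ _ (commutator_pow_mem hu (mem_tAdic_zero c) j)
  have h := isSum_antidiagonal (f := fun p q => ((((p + 1).factorial : K)⁻¹) •
      (commutator K u ^ p) c) * (((q.factorial : K)⁻¹) • u ^ q))
    (fun p q => (tAdic K S).mul_mem (hmem p) (exp_term_mem hu q))
    (fun p => (tAdic K S).mul_mem (hmem p) (mem_tAdic_zero ((tAdic K S).exp u)))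
    (fun p => isSum_mul_left (isSum_exp hu) _) (isSum_mul_right hw _)
  convert h using 2 with m
  -- Left multiplication by u is D + R, with D = ad u and R right multiplication, and D commutes
  -- with R. So the Leibniz sum expands in DᵖR^(m-p), and C(m+1,p+1)/(m+1)! = 1/((p+1)!(m-p)!) makes
  -- it the m-th Cauchy product term.
  have hcomm : Commute (LinearMap.mulLeft K u) (LinearMap.mulRight K u) :=
    LinearMap.commute_mulLeft_right u u
  have hDR : Commute (commutator K u) (LinearMap.mulRight K u) :=
    hcomm.sub_left (Commute.refl _)
  have key := congrArg (fun T : Module.End K (PowerSeries S) => T c)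
    (sum_choose_mul_pow_eq hDR m)
  have hadd : commutator K u + LinearMap.mulRight K u = LinearMap.mulLeft K u :=
    sub_add_cancel _ _
  simp only [hadd, LinearMap.sum_apply] at key
  have e1 : ∀ i, (LinearMap.mulLeft K u ^ i * LinearMap.mulRight K u ^ (m - i)) c =
      u ^ i * c * u ^ (m - i) := fun i => by
    rw [LinearMap.pow_mulLeft, LinearMap.pow_mulRight, Module.End.mul_apply,
      LinearMap.mulLeft_apply, LinearMap.mulRight_apply, mul_assoc]
  rw [← Finset.sum_congr rfl fun i _ => e1 i, ← key, Finset.smul_sum]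
  refine Finset.sum_congr rfl fun p hp => ?_
  have hp' : p ≤ m := Nat.lt_succ_iff.mp (Finset.mem_range.mp hp)
  rw [(hDR.pow_pow p (m - p)).eq, Module.End.mul_apply, Module.End.mul_apply,
    LinearMap.pow_mulRight, LinearMap.mulRight_apply, Module.End.natCast_apply,
    smul_mul_assoc, mul_smul_comm, smul_smul, ← Nat.cast_smul_eq_nsmul K, smul_smul]
  congr 1
  rw [Nat.cast_choose K (show p + 1 ≤ m + 1 by omega), show m + 1 - (p + 1) = m - p by omega]
  have := Nat.cast_ne_zero (R := K).2 (Nat.factorial_ne_zero (m + 1))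
  have := Nat.cast_ne_zero (R := K).2 (Nat.factorial_ne_zero (m - p))
  have := Nat.cast_ne_zero (R := K).2 (Nat.factorial_ne_zero (p + 1))
  field_simp

end TAdic

section Formal

variable {B : Type*} [NormedRing B] [NormedAlgebra ℝ B]

theorem tMul_mem (a : C(ℝ, B)) : tMul a ∈ (tAdic ℝ C(ℝ, B)).filt 1 := fun i hi => by
  rw [tMul, PowerSeries.coeff_monomial, if_neg (by omega)]

theorem formalP_mem {n : ℕ} {f : PowerSeries C(ℝ, B)} (hf : f ∈ (tAdic ℝ C(ℝ, B)).filt n) :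
    formalP f ∈ (tAdic ℝ C(ℝ, B)).filt n := fun i hi => by
  rw [coeff_formalP, hf i hi, map_zero]

theorem formalP_sub_mem {n : ℕ} {f g : PowerSeries C(ℝ, B)}
    (h : f - g ∈ (tAdic ℝ C(ℝ, B)).filt n) :
    formalP f - formalP g ∈ (tAdic ℝ C(ℝ, B)).filt n := by
  rw [← map_sub]; exact formalP_mem h

/-! ### Convergence of the BCH-recursion and its fixed point. -/

section Recursion

variable [CompleteSpace B] (a : C(ℝ, B))

/-- The two claims need a joint induction: convergence requires the iterate to lie in A₁, and
without convergence `sum` would return its default value 0. -/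
theorem chiIter_mem_and_isSum (k : ℕ) :
    (magnusRB B).chiIter (tMul a) k ∈ (tAdic ℝ C(ℝ, B)).filt 1 ∧
      (tAdic ℝ C(ℝ, B)).IsSum (adTerm ℝ (formalP ((magnusRB B).chiIter (tMul a) k)) (tMul a))
        ((magnusRB B).chiIter (tMul a) (k + 1)) := by
  have step : ∀ c ∈ (tAdic ℝ C(ℝ, B)).filt 1,
      (tAdic ℝ C(ℝ, B)).IsSum (adTerm ℝ (formalP c) (tMul a))
        ((tAdic ℝ C(ℝ, B)).sum (adTerm ℝ (formalP c) (tMul a))) := fun c hc => by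
    obtain ⟨s, hs⟩ := exists_isSum_tAdic (adTerm_mem_right (w := tMul a) (formalP_mem hc))
    rwa [hs.sum_eq]
  induction k with
  | zero => exact ⟨tMul_mem a, step _ (tMul_mem a)⟩
  | succ k ih =>
    have hmem : (magnusRB B).chiIter (tMul a) (k + 1) ∈ (tAdic ℝ C(ℝ, B)).filt 1 :=
      mem_of_isSum (adTerm_mem_right (formalP_mem ih.1))
        (fun n => (tAdic ℝ C(ℝ, B)).antitone (Nat.le_add_right 1 n)
          (adTerm_mem (formalP_mem ih.1) (tMul_mem a) n)) ih.2
    exact ⟨hmem, step _ hmem⟩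

theorem isLimit_chiIter :
    (tAdic ℝ C(ℝ, B)).IsLimit ((magnusRB B).chiIter (tMul a)) (chiZero a) := by
  have hstep : ∀ k, (magnusRB B).chiIter (tMul a) (k + 1) - (magnusRB B).chiIter (tMul a) k ∈
      (tAdic ℝ C(ℝ, B)).filt k := by
    intro k
    induction k with
    | zero => exact mem_tAdic_zero _
    | succ k ih =>
      exact isSum_adTerm_sub_mem (formalP_mem (chiIter_mem_and_isSum a (k + 1)).1)
        (formalP_mem (chiIter_mem_and_isSum a k).1) (tMul_mem a) (formalP_sub_mem ih)
        (chiIter_mem_and_isSum a (k + 1)).2 (chiIter_mem_and_isSum a k).2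
  obtain ⟨l, hl⟩ := (tAdic ℝ C(ℝ, B)).complete _ hstep
  have hlim : (tAdic ℝ C(ℝ, B)).IsLimit ((magnusRB B).chiIter (tMul a)) l :=
    fun N => ⟨N, fun m hm => (tAdic ℝ C(ℝ, B)).antitone hm (hl m)⟩
  have e : chiZero a = l := hlim.lim_eq
  rwa [e]

theorem chiZero_mem : chiZero a ∈ (tAdic ℝ C(ℝ, B)).filt 1 := by
  obtain ⟨M, hM⟩ := isLimit_chiIter a 1
  have := Submodule.add_mem _ (hM M le_rfl) (chiIter_mem_and_isSum a M).1
  rwa [sub_add_cancel] at this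

/-- By the contraction estimate the series at the limit sums to a limit of the shifted iterates, and
limits are unique. -/
theorem isSum_chiZero :
    (tAdic ℝ C(ℝ, B)).IsSum (adTerm ℝ (formalP (chiZero a)) (tMul a)) (chiZero a) := by
  obtain ⟨s, hs⟩ :=
    exists_isSum_tAdic (adTerm_mem_right (w := tMul a) (formalP_mem (chiZero_mem a)))
  have hlim : (tAdic ℝ C(ℝ, B)).IsLimit ((magnusRB B).chiIter (tMul a)) s := by
    intro N
    obtain ⟨M, hM⟩ := isLimit_chiIter a N
    refine ⟨M + 1, fun m hm => ?_⟩
    obtain ⟨k, rfl⟩ : ∃ k, m = k + 1 := ⟨m - 1, by omega⟩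
    exact (tAdic ℝ C(ℝ, B)).antitone (Nat.le_succ N) <|
      isSum_adTerm_sub_mem (formalP_mem (chiZero_mem a))
        (formalP_mem (chiIter_mem_and_isSum a k).1) (tMul_mem a)
        (formalP_sub_mem (hM k (by omega))) hs (chiIter_mem_and_isSum a k).2
  rwa [(isLimit_chiIter a).unique hlim] at hs ⊢

theorem isSum_adTerm_formalP_iff {c : PowerSeries C(ℝ, B)}
    (hc : c ∈ (tAdic ℝ C(ℝ, B)).filt 1) :
    (tAdic ℝ C(ℝ, B)).IsSum (adTerm ℝ (formalP c) (tMul a)) c ↔ c = chiZero a := by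
  refine ⟨fun h => sub_eq_zero.mp ((tAdic ℝ C(ℝ, B)).separated _ fun N => ?_), ?_⟩
  · induction N with
    | zero => exact mem_tAdic_zero _
    | succ N ih =>
      exact isSum_adTerm_sub_mem (formalP_mem hc) (formalP_mem (chiZero_mem a)) (tMul_mem a)
        (formalP_sub_mem ih) h (isSum_chiZero a)
  · rintro rfl
    exact isSum_chiZero a

end Recursion

/-! ### Formal derivatives -/

omit [NormedAlgebra ℝ B] in
theorem term_mul (f g : PowerSeries C(ℝ, B)) (n : ℕ) (x : ℝ) :
    term (f * g) n x = ∑ p ∈ Finset.HasAntidiagonal.antidiagonal n, term f p.1 x * term g p.2 x := by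
  simp [term, PowerSeries.coeff_mul, ContinuousMap.sum_apply]

theorem HasFormalDeriv.mul {f f' g g' : PowerSeries C(ℝ, B)} (hf : HasFormalDeriv f f')
    (hg : HasFormalDeriv g g') : HasFormalDeriv (f * g) (f' * g + f * g') := fun n x => by
  have e : term (f * g) n =
      fun x => ∑ p ∈ Finset.HasAntidiagonal.antidiagonal n, term f p.1 x * term g p.2 x :=
    funext (term_mul f g n)
  have e' : term (f' * g + f * g') n x = ∑ p ∈ Finset.HasAntidiagonal.antidiagonal n,
      (term f' p.1 x * term g p.2 x + term f p.1 x * term g' p.2 x) := by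
    rw [Finset.sum_add_distrib, ← term_mul, ← term_mul]
    simp [term]
  rw [e, e']
  exact HasDerivAt.fun_sum fun p _ => (hf p.1 x).mul (hg p.2 x)

theorem HasFormalDeriv.smul {f f' : PowerSeries C(ℝ, B)} (hf : HasFormalDeriv f f') (r : ℝ) :
    HasFormalDeriv (r • f) (r • f') := fun n x => (hf n x).const_smul r

theorem hasFormalDeriv_one : HasFormalDeriv (1 : PowerSeries C(ℝ, B)) 0 := fun n x => by
  have : term (1 : PowerSeries C(ℝ, B)) n = fun _ => if n = 0 then 1 else 0 := by
    funext x
    rw [term, PowerSeries.coeff_one]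
    split_ifs <;> rfl
  rw [this]
  exact hasDerivAt_const x _

theorem HasFormalDeriv.pow {u c : PowerSeries C(ℝ, B)} (h : HasFormalDeriv u c) (m : ℕ) :
    HasFormalDeriv (u ^ (m + 1)) (∑ i ∈ Finset.range (m + 1), u ^ i * c * u ^ (m - i)) := by
  induction m with
  | zero => simpa using h
  | succ m ih =>
    have := ih.mul h
    rw [← pow_succ] at this
    convert this using 1
    rw [Finset.sum_range_succ, Nat.sub_self, pow_zero, mul_one, Finset.sum_mul]
    congr 1
    refine Finset.sum_congr rfl fun i hi => ?_
    rw [Nat.succ_sub (Nat.lt_succ_iff.mp (Finset.mem_range.mp hi)), pow_succ, mul_assoc _ _ u,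
      mul_assoc]

/-- No uniform convergence is needed: for fixed n, one common finite partial sum gives the n-th
coefficient of both series. -/
theorem HasFormalDeriv.sum {f g : ℕ → PowerSeries C(ℝ, B)} {s s' : PowerSeries C(ℝ, B)}
    (hs : (tAdic ℝ C(ℝ, B)).IsSum f s) (hs' : (tAdic ℝ C(ℝ, B)).IsSum g s')
    (h : ∀ n, HasFormalDeriv (f n) (g n)) : HasFormalDeriv s s' := fun n x => by
  obtain ⟨M, hM⟩ := hs (n + 1)
  obtain ⟨M', hM'⟩ := hs' (n + 1)
  have e := hM (max M M') (le_max_left _ _) n n.lt_succ_self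
  have e' := hM' (max M M') (le_max_right _ _) n n.lt_succ_self
  rw [map_sub, map_sum, sub_eq_zero] at e e'
  have t : term s n = fun x => ∑ i ∈ Finset.range (max M M'), term (f i) n x := by
    funext x; simp [term, e, ContinuousMap.sum_apply]
  have t' : term s' n x = ∑ i ∈ Finset.range (max M M'), term (g i) n x := by
    simp [term, e', ContinuousMap.sum_apply]
  rw [t, t']
  exact HasDerivAt.fun_sum fun i _ => h i n x

theorem isSum_of_succ {K S : Type*} [Field K] [Ring S] [Algebra K S] {g : ℕ → PowerSeries S}
    {s : PowerSeries S} (h0 : g 0 = 0) (h : (tAdic K S).IsSum (fun n => g (n + 1)) s) :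
    (tAdic K S).IsSum g s := fun N => by
  obtain ⟨M, hM⟩ := h N
  refine ⟨M + 1, fun m hm => ?_⟩
  obtain ⟨k, rfl⟩ : ∃ k, m = k + 1 := ⟨m - 1, by omega⟩
  beta_reduce
  rw [Finset.sum_range_succ', h0, add_zero]
  exact hM k (by omega)

theorem hasFormalDeriv_exp {u w c : PowerSeries C(ℝ, B)} (hu : u ∈ (tAdic ℝ C(ℝ, B)).filt 1)
    (hd : HasFormalDeriv u c) (hc : (tAdic ℝ C(ℝ, B)).IsSum (adTerm ℝ u w) c) :
    HasFormalDeriv ((tAdic ℝ C(ℝ, B)).exp u) (w * (tAdic ℝ C(ℝ, B)).exp u) := by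
  -- The term u⁰ = 1 has derivative 0, so the derivative series starts at index 1 and must be
  -- shifted.
  let g : ℕ → PowerSeries C(ℝ, B) := fun n => match n with
    | 0 => 0
    | m + 1 => (((m + 1).factorial : ℝ)⁻¹) •
      ∑ i ∈ Finset.range (m + 1), u ^ i * c * u ^ (m - i)
  refine HasFormalDeriv.sum (isSum_exp hu)
    (isSum_of_succ (g := g) rfl (isSum_mul_exp hu (isSum_of_isSum_adTerm hu hc))) fun n => ?_
  rcases n with _ | m
  · simpa [g] using hasFormalDeriv_one
  · exact (hd.pow m).smul _

theorem hasFormalDeriv_formalP [CompleteSpace B] (f : PowerSeries C(ℝ, B)) :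
    HasFormalDeriv (formalP f) f := fun n x => by
  have e : term (formalP f) n = fun x => ∫ y in (0 : ℝ)..x, PowerSeries.coeff n f y := by
    funext x; rw [term, coeff_formalP]; rfl
  rw [e]
  exact intervalIntegral.integral_hasDerivAt_right
    ((PowerSeries.coeff n f).continuous.intervalIntegrable _ _)
    (PowerSeries.coeff n f).continuous.aestronglyMeasurable.stronglyMeasurableAtFilter
    (PowerSeries.coeff n f).continuous.continuousAt

theorem term_formalP (f : PowerSeries C(ℝ, B)) (n : ℕ) (x : ℝ) :
    term (formalP f) n x = ∫ y in (0 : ℝ)..x, term f n y := by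
  rw [term, coeff_formalP]; rfl

theorem evalAt_zero_formalP (f : PowerSeries C(ℝ, B)) : evalAt 0 (formalP f) = 0 := by
  ext n
  rw [evalAt, PowerSeries.coeff_mk, term_formalP, intervalIntegral.integral_same, map_zero]

/-- Stated for a single coefficient so that `formal_ivp_unique` can use it inductively. -/
theorem coeff_ext_of_deriv {f f' g g' : PowerSeries C(ℝ, B)} (hf : HasFormalDeriv f g)
    (hf' : HasFormalDeriv f' g') (h0 : evalAt 0 f = evalAt 0 f') {n : ℕ}
    (h : PowerSeries.coeff n g = PowerSeries.coeff n g') :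
    PowerSeries.coeff n f = PowerSeries.coeff n f' := by
  have hd : ∀ x, HasDerivAt (fun x => term f n x - term f' n x) 0 x := fun x => by
    have := (hf n x).sub (hf' n x)
    rwa [term, term, h, sub_self] at this
  ext x
  have h1 := is_const_of_deriv_eq_zero (fun x => (hd x).differentiableAt)
    (fun x => (hd x).deriv) x 0
  have h2 := congrArg (PowerSeries.coeff n) h0
  rw [evalAt, evalAt, PowerSeries.coeff_mk, PowerSeries.coeff_mk] at h2
  rw [h2, sub_self, sub_eq_zero] at h1
  exact h1

theorem ext_of_deriv {f f' g : PowerSeries C(ℝ, B)} (hf : HasFormalDeriv f g)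
    (hf' : HasFormalDeriv f' g) (h0 : evalAt 0 f = evalAt 0 f') : f = f' :=
  PowerSeries.ext fun _ => coeff_ext_of_deriv hf hf' h0 rfl

omit [NormedAlgebra ℝ B] in
theorem coeff_tMul_mul_zero (a : C(ℝ, B)) (E : PowerSeries C(ℝ, B)) :
    PowerSeries.coeff 0 (tMul a * E) = 0 := by
  simp [PowerSeries.coeff_mul, tMul, PowerSeries.coeff_monomial]

omit [NormedAlgebra ℝ B] in
theorem coeff_tMul_mul_succ (a : C(ℝ, B)) (E : PowerSeries C(ℝ, B)) (n : ℕ) :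
    PowerSeries.coeff (n + 1) (tMul a * E) = a * PowerSeries.coeff n E := by
  rw [PowerSeries.coeff_mul, Finset.sum_eq_single (1, n)]
  · simp [tMul]
  · rintro ⟨p, q⟩ hp hne
    have : p ≠ 1 := by
      rintro rfl
      have := Finset.HasAntidiagonal.mem_antidiagonal.mp hp
      exact hne (Prod.ext rfl (by simp at this ⊢; omega))
    simp [tMul, PowerSeries.coeff_monomial, this]
  · intro h; exact absurd (Finset.HasAntidiagonal.mem_antidiagonal.mpr (add_comm 1 n)) h

/-- Multiplication by ta shifts degrees, so the n-th coefficient of E determines the derivative of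
the next one. -/
theorem formal_ivp_unique {a : C(ℝ, B)} {E E' : PowerSeries C(ℝ, B)}
    (hE : HasFormalDeriv E (tMul a * E)) (hE' : HasFormalDeriv E' (tMul a * E'))
    (h0 : evalAt 0 E = evalAt 0 E') : E = E' := by
  ext1 n
  induction n with
  | zero => exact coeff_ext_of_deriv hE hE' h0 (by simp only [coeff_tMul_mul_zero])
  | succ n ih => exact coeff_ext_of_deriv hE hE' h0 (by simp only [coeff_tMul_mul_succ, ih])

/-! ### Scalar extension of formal series -/

theorem map_mem_tAdic {S T : Type*} [Ring S] [Algebra ℝ S] [Ring T] [Algebra ℝ T] (φ : S →ₐ[ℝ] T)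
    {n : ℕ} {f : PowerSeries S} (hf : f ∈ (tAdic ℝ S).filt n) :
    PowerSeries.map (φ : S →+* T) f ∈ (tAdic ℝ T).filt n := fun i hi => by
  rw [PowerSeries.coeff_map, hf i hi, map_zero]

/-- Used for evaluation at a point and restriction to [-δ, δ], which carry formal identities over
C(ℝ, B) to normed coefficient algebras. -/
theorem isSum_map {S T : Type*} [Ring S] [Algebra ℝ S] [Ring T] [Algebra ℝ T] (φ : S →ₐ[ℝ] T)
    {f : ℕ → PowerSeries S} {s : PowerSeries S} (h : (tAdic ℝ S).IsSum f s) :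
    (tAdic ℝ T).IsSum (fun n => PowerSeries.map (φ : S →+* T) (f n))
      (PowerSeries.map (φ : S →+* T) s) := fun N => by
  obtain ⟨M, hM⟩ := h N
  refine ⟨M, fun m hm => ?_⟩
  have := map_mem_tAdic φ (hM m hm)
  rwa [map_sub, map_sum] at this

theorem map_smul_powerSeries {S T : Type*} [Ring S] [Algebra ℝ S] [Ring T] [Algebra ℝ T]
    (φ : S →ₐ[ℝ] T) (r : ℝ) (f : PowerSeries S) :
    PowerSeries.map (φ : S →+* T) (r • f) = r • PowerSeries.map (φ : S →+* T) f := by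
  ext n
  simp

theorem map_adTerm {S T : Type*} [Ring S] [Algebra ℝ S] [Ring T] [Algebra ℝ T]
    (φ : S →ₐ[ℝ] T) (u w : PowerSeries S) (n : ℕ) :
    PowerSeries.map (φ : S →+* T) (adTerm ℝ u w n) =
      adTerm ℝ (PowerSeries.map (φ : S →+* T) u) (PowerSeries.map (φ : S →+* T) w) n := by
  rw [adTerm, adTerm, map_smul_powerSeries]
  congr 1
  induction n with
  | zero => rfl
  | succ n ih =>
    rw [Function.iterate_succ_apply', Function.iterate_succ_apply', map_sub, map_mul, map_mul, ih]

theorem map_exp {S T : Type*} [Ring S] [Algebra ℝ S] [Ring T] [Algebra ℝ T]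
    (φ : S →ₐ[ℝ] T) {u : PowerSeries S} (hu : u ∈ (tAdic ℝ S).filt 1) :
    PowerSeries.map (φ : S →+* T) ((tAdic ℝ S).exp u) =
      (tAdic ℝ T).exp (PowerSeries.map (φ : S →+* T) u) := by
  have h := isSum_map φ (isSum_exp hu)
  simp only [map_smul_powerSeries, map_pow] at h
  exact h.sum_eq.symm

/-- Evaluation at `x` as an algebra homomorphism. -/
def evalHom (B : Type*) [NormedRing B] [NormedAlgebra ℝ B] (x : ℝ) : C(ℝ, B) →ₐ[ℝ] B where
  toFun f := f x
  map_one' := rfl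
  map_mul' _ _ := rfl
  map_zero' := rfl
  map_add' _ _ := rfl
  commutes' _ := rfl

theorem evalAt_eq_map (x : ℝ) (f : PowerSeries C(ℝ, B)) :
    evalAt x f = PowerSeries.map (evalHom B x : C(ℝ, B) →+* B) f := by
  ext n
  rw [evalAt, PowerSeries.coeff_mk, PowerSeries.coeff_map]; rfl

theorem evalAt_exp {u : PowerSeries C(ℝ, B)} (hu : u ∈ (tAdic ℝ C(ℝ, B)).filt 1) (x : ℝ) :
    evalAt x ((tAdic ℝ C(ℝ, B)).exp u) = (tAdic ℝ B).exp (evalAt x u) := by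
  rw [evalAt_eq_map, evalAt_eq_map, map_exp _ hu]

theorem tAdic_exp_zero {S : Type*} [Ring S] [Algebra ℝ S] :
    (tAdic ℝ S).exp (0 : PowerSeries S) = 1 := by
  have h0 : (0 : PowerSeries S) ∈ (tAdic ℝ S).filt 1 := Submodule.zero_mem _
  refine (isSum_exp h0).unique fun N => ⟨1, fun m hm => ?_⟩
  beta_reduce
  rw [Finset.sum_eq_single 0]
  · simp
  · intro n _ hn; simp [hn]
  · intro h; exact absurd (Finset.mem_range.mpr (by omega)) h

/-! ### The two characterisations of Magnus' expansion. -/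

section Magnus

variable [CompleteSpace B] (a : C(ℝ, B))

theorem isMagnusExponent_formalP : IsMagnusExponent a (formalP (chiZero a)) where
  mem := formalP_mem (chiZero_mem a)
  initial := evalAt_zero_formalP _
  deriv_exp := hasFormalDeriv_exp (formalP_mem (chiZero_mem a)) (hasFormalDeriv_formalP _)
    (isSum_chiZero a)
  initial_exp := by
    rw [evalAt_exp (formalP_mem (chiZero_mem a)), evalAt_zero_formalP, tAdic_exp_zero]

theorem isMagnusExponent_iff (Ω : PowerSeries C(ℝ, B)) :
    IsMagnusExponent a Ω ↔ Ω = formalP (chiZero a) := by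
  have h0 := isMagnusExponent_formalP a
  refine ⟨fun h => exp_injOn (K := ℝ) h.mem h0.mem ?_, fun h => h ▸ h0⟩
  exact formal_ivp_unique h.deriv_exp h0.deriv_exp (h.initial_exp.trans h0.initial_exp.symm)

/-- Ω' = D and Ω(0) = 0 give Ω = P(D), so Magnus' equation says that D is a fixed point of the
BCH-recursion. -/
theorem satisfiesMagnusRecursion_iff (Ω : PowerSeries C(ℝ, B)) :
    SatisfiesMagnusRecursion a Ω ↔ Ω = formalP (chiZero a) := by
  constructor
  · rintro ⟨hmem, h0, D, hD, hd⟩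
    have e : Ω = formalP D := ext_of_deriv hd (hasFormalDeriv_formalP D)
      (h0.trans (evalAt_zero_formalP D).symm)
    have hDmem : D ∈ (tAdic ℝ C(ℝ, B)).filt 1 := mem_of_isSum (adTerm_mem_right hmem)
      (fun n => (tAdic ℝ C(ℝ, B)).antitone (Nat.le_add_right 1 n)
        (adTerm_mem hmem (tMul_mem a) n)) hD
    rw [e] at hD
    rw [e, (isSum_adTerm_formalP_iff a hDmem).1 hD]
  · rintro rfl
    exact ⟨formalP_mem (chiZero_mem a), evalAt_zero_formalP _, _, isSum_chiZero a,
      hasFormalDeriv_formalP _⟩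

end Magnus

end Formal

/-! ### ℓ¹-estimates in [0, ∞], and setting t = 1. -/

section AbsoluteConvergence

open scoped ENNReal

theorem tsum_sum_antidiagonal (h : ℕ × ℕ → ℝ≥0∞) :
    ∑' n, ∑ p ∈ Finset.HasAntidiagonal.antidiagonal n, h p = ∑' p, h p := by
  rw [← Finset.HasAntidiagonal.sigmaAntidiagonalEquivProd.tsum_eq h, ENNReal.tsum_sigma']
  refine tsum_congr fun n => ?_
  rw [tsum_fintype]
  exact (Finset.sum_coe_sort _ h).symm

theorem two_pow_le_factorial_succ (n : ℕ) : 2 ^ n ≤ (n + 1).factorial := by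
  induction n with
  | zero => simp
  | succ n ih =>
    rw [pow_succ', Nat.factorial_succ]
    exact Nat.mul_le_mul (by omega) ih

/-- The recursion expresses bₙ₊₁ as -∑ b_{n-j}/(j+2)!, and 1/(j+2)! ≤ 2^{-(j+1)} leaves a geometric
sum of at most 1. -/
theorem abs_bCoeff_le (n : ℕ) : |bCoeff ℝ n| ≤ 1 := by
  induction n using Nat.strong_induction_on with
  | _ n ih =>
    rcases n with _ | n
    · simp [bCoeff]
    · have h := sum_bCoeff_mul_inv_factorial ℝ (n + 1)
      rw [if_neg (Nat.succ_ne_zero n), Finset.sum_range_succ'] at h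
      simp only [zero_add, Nat.factorial_one, Nat.cast_one, inv_one, one_mul, Nat.sub_zero] at h
      rw [eq_neg_of_add_eq_zero_right h, abs_neg]
      refine (Finset.abs_sum_le_sum_abs _ _).trans ?_
      have hb : ∀ j ∈ Finset.range (n + 1),
          |(((j + 1 + 1).factorial : ℝ)⁻¹) * bCoeff ℝ (n + 1 - (j + 1))| ≤
            (1 / 2 : ℝ) ^ j * (1 / 2) := fun j hj => by
        rw [abs_mul, abs_of_nonneg (by positivity)]
        have h1 := ih (n + 1 - (j + 1)) (by omega)
        have h2 : (2 : ℝ) ^ (j + 1) ≤ ((j + 1 + 1).factorial : ℝ) := by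
          exact_mod_cast two_pow_le_factorial_succ (j + 1)
        calc _ ≤ (((j + 1 + 1).factorial : ℝ)⁻¹) * 1 := by gcongr
          _ ≤ ((2 : ℝ) ^ (j + 1))⁻¹ := by rw [mul_one]; gcongr
          _ = _ := by rw [← one_div, ← one_div_pow, pow_succ]
      refine (Finset.sum_le_sum hb).trans ?_
      rw [← Finset.sum_mul, geom_sum_eq (by norm_num)]
      have : (0 : ℝ) ≤ (1 / 2) ^ (n + 1) := by positivity
      norm_num
      linarith

variable {S : Type*} [NormedRing S] [NormedAlgebra ℝ S]

/-- The `ℓ¹`-norm of the sequence of coefficients. -/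
noncomputable def ellOne (f : PowerSeries S) : ℝ≥0∞ := ∑' n, ‖PowerSeries.coeff n f‖ₑ

/-- The sum of the coefficients. -/
noncomputable def coeffSum (f : PowerSeries S) : S := ∑' n, PowerSeries.coeff n f

omit [NormedAlgebra ℝ S] in
theorem ellOne_ne_top_iff {f : PowerSeries S} :
    ellOne f ≠ ∞ ↔ Summable fun n => ‖PowerSeries.coeff n f‖ :=
  tsum_enorm_ne_top_iff_summable_norm

omit [NormedAlgebra ℝ S] in
theorem ellOne_monomial (n : ℕ) (x : S) : ellOne (PowerSeries.monomial n x) = ‖x‖ₑ := by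
  rw [ellOne, tsum_eq_single n]
  · simp
  · intro m hm; simp [PowerSeries.coeff_monomial, hm]

omit [NormedAlgebra ℝ S] in
theorem coeffSum_monomial (n : ℕ) (x : S) : coeffSum (PowerSeries.monomial n x) = x := by
  rw [coeffSum, tsum_eq_single n]
  · simp
  · intro m hm; simp [PowerSeries.coeff_monomial, hm]

omit [NormedAlgebra ℝ S] in
theorem ellOne_mul_le (f g : PowerSeries S) : ellOne (f * g) ≤ ellOne f * ellOne g := by
  calc ellOne (f * g) ≤ ∑' n, ∑ p ∈ Finset.HasAntidiagonal.antidiagonal n,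
        ‖PowerSeries.coeff p.1 f‖ₑ * ‖PowerSeries.coeff p.2 g‖ₑ := by
        refine ENNReal.tsum_le_tsum fun n => ?_
        rw [PowerSeries.coeff_mul]
        refine (enorm_sum_le _ _).trans (Finset.sum_le_sum fun p _ => ?_)
        simp only [enorm_eq_nnnorm]
        exact_mod_cast nnnorm_mul_le _ _
    _ = ellOne f * ellOne g := by
        rw [tsum_sum_antidiagonal, ENNReal.tsum_prod']
        simp only [ENNReal.tsum_mul_left, ENNReal.tsum_mul_right, ellOne]

omit [NormedAlgebra ℝ S] in
theorem ellOne_sub_le (f g : PowerSeries S) : ellOne (f - g) ≤ ellOne f + ellOne g := by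
  rw [ellOne, ellOne, ellOne, ← ENNReal.tsum_add]
  exact ENNReal.tsum_le_tsum fun n => by rw [map_sub]; exact enorm_sub_le

theorem ellOne_smul (r : ℝ) (f : PowerSeries S) : ellOne (r • f) = ‖r‖ₑ * ellOne f := by
  rw [ellOne, ellOne, ← ENNReal.tsum_mul_left]
  exact tsum_congr fun n => by rw [coeff_scalar_smul, enorm_smul]

-- The factor is there because ‖1‖ = 1 is not assumed.
omit [NormedAlgebra ℝ S] in
theorem ellOne_pow_le (u : PowerSeries S) (n : ℕ) :
    ellOne (u ^ n) ≤ ellOne (1 : PowerSeries S) * ellOne u ^ n := by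
  induction n with
  | zero => simp
  | succ n ih =>
    rw [pow_succ, pow_succ, ← mul_assoc]
    exact (ellOne_mul_le _ _).trans (mul_le_mul_left ih _)

omit [NormedAlgebra ℝ S] in
theorem ellOne_iterate_commutator_le (u w : PowerSeries S) (n : ℕ) :
    ellOne ((fun y : PowerSeries S => u * y - y * u)^[n] w) ≤ (2 * ellOne u) ^ n * ellOne w := by
  induction n with
  | zero => simp
  | succ n ih =>
    rw [Function.iterate_succ_apply']
    refine (ellOne_sub_le _ _).trans ?_
    refine (add_le_add (ellOne_mul_le _ _) (ellOne_mul_le _ _)).trans ?_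
    rw [mul_comm (ellOne _) (ellOne u), ← two_mul, ← mul_assoc, pow_succ', mul_assoc (2 * ellOne u)]
    exact mul_le_mul_right ih _

theorem ellOne_adTerm_le (u w : PowerSeries S) (n : ℕ) :
    ellOne (adTerm ℝ u w n) ≤ (2 * ellOne u) ^ n * ellOne w := by
  rw [adTerm, ellOne_smul]
  have : ‖bCoeff ℝ n‖ₑ ≤ 1 := by
    rw [Real.enorm_eq_ofReal_abs]
    exact ENNReal.ofReal_le_one.2 (abs_bCoeff_le n)
  calc _ ≤ 1 * ellOne _ := mul_le_mul_left this _
    _ ≤ _ := by rw [one_mul]; exact ellOne_iterate_commutator_le u w n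

theorem tsum_ellOne_adTerm_le {u : PowerSeries S} (hu : 2 * ellOne u ≤ 2⁻¹) (w : PowerSeries S) :
    ∑' n, ellOne (adTerm ℝ u w n) ≤ 2 * ellOne w := by
  calc _ ≤ ∑' n : ℕ, (2⁻¹ : ℝ≥0∞) ^ n * ellOne w := by
        refine ENNReal.tsum_le_tsum fun n => (ellOne_adTerm_le u w n).trans ?_
        gcongr
    _ = _ := by
        rw [ENNReal.tsum_mul_right, ENNReal.tsum_geometric, ENNReal.one_sub_inv_two, inv_inv]

theorem coeff_eq_tsum_of_isSum {f : ℕ → PowerSeries S} (hf : ∀ n, f n ∈ (tAdic ℝ S).filt n)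
    {s : PowerSeries S} (hs : (tAdic ℝ S).IsSum f s) (i : ℕ) :
    PowerSeries.coeff i s = ∑' n, PowerSeries.coeff i (f n) := by
  rw [(isSum_tAdic_iff hf).1 hs i, tsum_eq_sum]
  intro n hn
  exact hf n i (by simpa using hn)

theorem ellOne_le_of_isSum {f : ℕ → PowerSeries S} (hf : ∀ n, f n ∈ (tAdic ℝ S).filt n)
    {s : PowerSeries S} (hs : (tAdic ℝ S).IsSum f s) : ellOne s ≤ ∑' n, ellOne (f n) := by
  simp only [ellOne]
  rw [ENNReal.tsum_comm]
  refine ENNReal.tsum_le_tsum fun i => ?_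
  rw [coeff_eq_tsum_of_isSum hf hs i]
  exact enorm_tsum_le_tsum_enorm

/-- A Fatou-type argument: finitely many coefficients of the limit agree with those of a late
iterate. -/
theorem ellOne_le_of_isLimit {u : ℕ → PowerSeries S} {l : PowerSeries S}
    (h : (tAdic ℝ S).IsLimit u l) {C : ℝ≥0∞} (hC : ∀ k, ellOne (u k) ≤ C) : ellOne l ≤ C := by
  refine ENNReal.tsum_le_of_sum_range_le fun N => ?_
  obtain ⟨M, hM⟩ := h N
  rw [Finset.sum_congr rfl (g := fun i => ‖PowerSeries.coeff i (u M)‖ₑ)]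
  · exact (ENNReal.sum_le_tsum _).trans (hC M)
  · intro i hi
    have := hM M le_rfl i (Finset.mem_range.mp hi)
    rw [map_sub, sub_eq_zero] at this
    rw [this]

variable [CompleteSpace S]

/-- Fubini for the absolutely summable double family of coefficients: a t-adic sum becomes a
norm-convergent sum at t = 1. -/
theorem hasSum_coeffSum_of_isSum {f : ℕ → PowerSeries S}
    (hf : ∀ n, f n ∈ (tAdic ℝ S).filt n) {s : PowerSeries S} (hs : (tAdic ℝ S).IsSum f s)
    (hfin : ∑' n, ellOne (f n) ≠ ∞) : HasSum (fun n => coeffSum (f n)) (coeffSum s) := by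
  have hsum : Summable fun p : ℕ × ℕ => PowerSeries.coeff p.2 (f p.1) := by
    refine Summable.of_enorm ?_
    rwa [ENNReal.tsum_prod']
  have h1 := hsum.hasSum.prod_fiberwise fun n => (hsum.prod_factor n).hasSum
  have hsum' := hsum.prod_symm
  have h2 := hsum'.hasSum.prod_fiberwise fun i => (hsum'.prod_factor i).hasSum
  have e : coeffSum s = ∑' p : ℕ × ℕ, PowerSeries.coeff p.2 (f p.1) := by
    rw [coeffSum, tsum_congr (coeff_eq_tsum_of_isSum hf hs)]
    exact h2.tsum_eq.trans
      ((Equiv.prodComm ℕ ℕ).tsum_eq fun p : ℕ × ℕ => PowerSeries.coeff p.2 (f p.1))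
  rw [e]
  exact h1

omit [NormedAlgebra ℝ S] in
theorem coeffSum_mul {f g : PowerSeries S} (hf : ellOne f ≠ ∞) (hg : ellOne g ≠ ∞) :
    coeffSum (f * g) = coeffSum f * coeffSum g := by
  rw [coeffSum, coeffSum, coeffSum, tsum_mul_tsum_eq_tsum_sum_antidiagonal_of_summable_norm
    (ellOne_ne_top_iff.1 hf) (ellOne_ne_top_iff.1 hg)]
  exact tsum_congr fun n => PowerSeries.coeff_mul n f g

omit [NormedAlgebra ℝ S] in
theorem coeffSum_sub {f g : PowerSeries S} (hf : ellOne f ≠ ∞) (hg : ellOne g ≠ ∞) :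
    coeffSum (f - g) = coeffSum f - coeffSum g := by
  rw [coeffSum, coeffSum, coeffSum, ← Summable.tsum_sub (ellOne_ne_top_iff.1 hf).of_norm
    (ellOne_ne_top_iff.1 hg).of_norm]
  exact tsum_congr fun n => map_sub _ _ _

theorem coeffSum_smul (r : ℝ) {f : PowerSeries S} (hf : ellOne f ≠ ∞) :
    coeffSum (r • f) = r • coeffSum f := by
  rw [coeffSum, coeffSum, ← Summable.tsum_const_smul r (ellOne_ne_top_iff.1 hf).of_norm]
  exact tsum_congr fun n => coeff_scalar_smul _ _ _

omit [NormedAlgebra ℝ S] [CompleteSpace S] in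
theorem ellOne_one_ne_top : ellOne (1 : PowerSeries S) ≠ ∞ := by
  have := ellOne_monomial 0 (1 : S)
  rw [PowerSeries.monomial_zero_eq_C_apply, map_one] at this
  rw [this]
  exact enorm_ne_top

omit [NormedAlgebra ℝ S] [CompleteSpace S] in
theorem ellOne_pow_ne_top {u : PowerSeries S} (hu : ellOne u ≠ ∞) (n : ℕ) :
    ellOne (u ^ n) ≠ ∞ :=
  ne_top_of_le_ne_top (ENNReal.mul_ne_top ellOne_one_ne_top (ENNReal.pow_ne_top hu))
    (ellOne_pow_le u n)

omit [NormedAlgebra ℝ S] in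
theorem coeffSum_pow {u : PowerSeries S} (hu : ellOne u ≠ ∞) (n : ℕ) :
    coeffSum (u ^ n) = coeffSum u ^ n := by
  induction n with
  | zero =>
    have := coeffSum_monomial 0 (1 : S)
    rw [PowerSeries.monomial_zero_eq_C_apply, map_one] at this
    rw [pow_zero, pow_zero, this]
  | succ n ih => rw [pow_succ, pow_succ, coeffSum_mul (ellOne_pow_ne_top hu n) hu, ih]

theorem coeffSum_adTerm {u w : PowerSeries S} (hu : ellOne u ≠ ∞) (hw : ellOne w ≠ ∞) (n : ℕ) :
    coeffSum (adTerm ℝ u w n) = adTerm ℝ (coeffSum u) (coeffSum w) n := by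
  have hfin : ∀ n, ellOne ((fun y : PowerSeries S => u * y - y * u)^[n] w) ≠ ∞ := fun n =>
    ne_top_of_le_ne_top (ENNReal.mul_ne_top
      (ENNReal.pow_ne_top (ENNReal.mul_ne_top ENNReal.ofNat_ne_top hu)) hw)
      (ellOne_iterate_commutator_le u w n)
  rw [adTerm, adTerm, coeffSum_smul _ (hfin n)]
  congr 1
  induction n with
  | zero => rfl
  | succ n ih =>
    have h := hfin n
    rw [Function.iterate_succ_apply', Function.iterate_succ_apply', ← ih,
      coeffSum_sub (ne_top_of_le_ne_top (ENNReal.mul_ne_top hu h) (ellOne_mul_le _ _))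
        (ne_top_of_le_ne_top (ENNReal.mul_ne_top h hu) (ellOne_mul_le _ _)),
      coeffSum_mul hu h, coeffSum_mul h hu]

/-- `coeffSum` commutes with powers by Cauchy products; the interchange is justified by the majorant
‖1‖ ∑ ‖u‖ⁿ/n!, with ‖u‖ the ℓ¹-norm. -/
theorem coeffSum_exp {u : PowerSeries S} (hu : u ∈ (tAdic ℝ S).filt 1) (hfin : ellOne u ≠ ∞) :
    coeffSum ((tAdic ℝ S).exp u) = NormedSpace.exp (coeffSum u) := by
  have h := hasSum_coeffSum_of_isSum (exp_term_mem hu) (isSum_exp hu) ?_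
  · simp only [coeffSum_smul _ (ellOne_pow_ne_top hfin _), coeffSum_pow hfin] at h
    exact h.unique (NormedSpace.exp_series_hasSum_exp' (𝕂 := ℝ) (coeffSum u))
  · have hb : ∀ n, ellOne (((n.factorial : ℝ)⁻¹) • u ^ n) ≤
        ENNReal.ofReal ((ellOne u).toReal ^ n / n.factorial) * ellOne (1 : PowerSeries S) := by
      intro n
      rw [ellOne_smul, Real.enorm_eq_ofReal (by positivity), div_eq_inv_mul,
        ENNReal.ofReal_mul (by positivity), ENNReal.ofReal_pow ENNReal.toReal_nonneg,
        ENNReal.ofReal_toReal hfin, mul_assoc, mul_comm (ellOne u ^ n)]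
      exact mul_le_mul_right (ellOne_pow_le u n) _
    refine ne_top_of_le_ne_top ?_ (ENNReal.tsum_le_tsum hb)
    rw [ENNReal.tsum_mul_right]
    refine ENNReal.mul_ne_top ?_ ellOne_one_ne_top
    rw [← ENNReal.ofReal_tsum_of_nonneg (fun n => by positivity)
      (Real.summable_pow_div_factorial _)]
    exact ENNReal.ofReal_ne_top

end AbsoluteConvergence

/-! ### From formal series to functions: evaluation, restriction and uniform bounds. -/

section InitialValueProblem

open scoped ENNReal

variable {B : Type*} [NormedRing B] [NormedAlgebra ℝ B]

theorem map_tMul {T : Type*} [Ring T] [Algebra ℝ T] (φ : C(ℝ, B) →ₐ[ℝ] T) (a : C(ℝ, B)) :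
    PowerSeries.map (φ : C(ℝ, B) →+* T) (tMul a) = PowerSeries.monomial 1 (φ a) := by
  ext n
  rw [PowerSeries.coeff_map, tMul, PowerSeries.coeff_monomial, PowerSeries.coeff_monomial]
  split_ifs <;> simp

theorem term_eq_coeff_map (f : PowerSeries C(ℝ, B)) (n : ℕ) (x : ℝ) :
    term f n x = PowerSeries.coeff n (PowerSeries.map (evalHom B x : C(ℝ, B) →+* B) f) := by
  rw [PowerSeries.coeff_map]; rfl

theorem value_eq_coeffSum (f : PowerSeries C(ℝ, B)) (x : ℝ) :
    value f x = coeffSum (PowerSeries.map (evalHom B x : C(ℝ, B) →+* B) f) :=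
  tsum_congr fun n => term_eq_coeff_map f n x

theorem summable_norm_term_iff {f : PowerSeries C(ℝ, B)} {x : ℝ} :
    (Summable fun n => ‖term f n x‖) ↔
      ellOne (PowerSeries.map (evalHom B x : C(ℝ, B) →+* B) f) ≠ ∞ := by
  simp only [ellOne_ne_top_iff, term_eq_coeff_map]

/-- Restriction to `[-δ, δ]` as an algebra homomorphism. -/
def restrictHom (B : Type*) [NormedRing B] [NormedAlgebra ℝ B] (δ : ℝ) :
    C(ℝ, B) →ₐ[ℝ] C(Set.Icc (-δ) δ, B) where
  toFun f := f.restrict _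
  map_one' := rfl
  map_mul' _ _ := rfl
  map_zero' := rfl
  map_add' _ _ := rfl
  commutes' _ := rfl

theorem norm_apply_le_restrictHom {δ x : ℝ} (hx : x ∈ Set.Icc (-δ) δ) (f : C(ℝ, B)) :
    ‖f x‖ ≤ ‖restrictHom B δ f‖ :=
  (restrictHom B δ f).norm_coe_le_norm ⟨x, hx⟩

theorem norm_restrictHom_riemannP_le {δ : ℝ} (hδ : 0 ≤ δ) (f : C(ℝ, B)) :
    ‖restrictHom B δ (riemannP f)‖ ≤ δ * ‖restrictHom B δ f‖ := by
  refine (ContinuousMap.norm_le _ (by positivity)).2 ?_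
  rintro ⟨x, hx⟩
  have hx' : |x| ≤ δ := abs_le.2 hx
  have h : ‖∫ y in (0 : ℝ)..x, f y‖ ≤ ‖restrictHom B δ f‖ * |x - 0| := by
    refine intervalIntegral.norm_integral_le_of_norm_le_const fun y hy => ?_
    refine norm_apply_le_restrictHom ?_ f
    have := Set.uIcc_subset_Icc (show (0 : ℝ) ∈ Set.Icc (-δ) δ from ⟨by linarith, hδ⟩) hx
    exact this (Set.uIoc_subset_uIcc hy)
  calc _ ≤ _ := h
    _ ≤ ‖restrictHom B δ f‖ * δ := by rw [sub_zero]; gcongr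
    _ = _ := mul_comm _ _

theorem ellOne_restrictHom_formalP_le {δ : ℝ} (hδ : 0 ≤ δ) (f : PowerSeries C(ℝ, B)) :
    ellOne (PowerSeries.map (restrictHom B δ : C(ℝ, B) →+* C(Set.Icc (-δ) δ, B)) (formalP f)) ≤
      ENNReal.ofReal δ * ellOne (PowerSeries.map (restrictHom B δ : C(ℝ, B) →+* C(Set.Icc (-δ) δ, B)) f) := by
  rw [ellOne, ellOne, ← ENNReal.tsum_mul_left]
  refine ENNReal.tsum_le_tsum fun n => ?_
  rw [PowerSeries.coeff_map, PowerSeries.coeff_map, coeff_formalP, ← ofReal_norm, ← ofReal_norm,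
    ← ENNReal.ofReal_mul hδ]
  exact ENNReal.ofReal_le_ofReal (norm_restrictHom_riemannP_le hδ _)

theorem ellOne_evalHom_le {δ x : ℝ} (hx : x ∈ Set.Icc (-δ) δ) (f : PowerSeries C(ℝ, B)) :
    ellOne (PowerSeries.map (evalHom B x : C(ℝ, B) →+* B) f) ≤
      ellOne (PowerSeries.map (restrictHom B δ : C(ℝ, B) →+* C(Set.Icc (-δ) δ, B)) f) := by
  refine ENNReal.tsum_le_tsum fun n => ?_
  rw [PowerSeries.coeff_map, PowerSeries.coeff_map, ← ofReal_norm, ← ofReal_norm]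
  exact ENNReal.ofReal_le_ofReal (norm_apply_le_restrictHom hx _)

variable [CompleteSpace B] (a : C(ℝ, B))

/-- The ball of radius 2‖a‖ is invariant: integration over [-δ, δ] contributes a factor δ, so the
hypothesis puts P(c) in the range of `tsum_ellOne_adTerm_le`. The bound passes to the limit. -/
theorem ellOne_restrictHom_chiZero_le {δ : ℝ} (hδ : 0 ≤ δ)
    (h : 2 * (ENNReal.ofReal δ * (2 * ‖restrictHom B δ a‖ₑ)) ≤ 2⁻¹) :
    ellOne (PowerSeries.map (restrictHom B δ : C(ℝ, B) →+* C(Set.Icc (-δ) δ, B)) (chiZero a)) ≤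
      2 * ‖restrictHom B δ a‖ₑ := by
  have hta : ellOne (PowerSeries.map (restrictHom B δ : C(ℝ, B) →+* C(Set.Icc (-δ) δ, B)) (tMul a)) =
      ‖restrictHom B δ a‖ₑ := by
    rw [map_tMul, ellOne_monomial]
  refine ellOne_le_of_isLimit (u := fun k => PowerSeries.map (restrictHom B δ : C(ℝ, B) →+* C(Set.Icc (-δ) δ, B))
    ((magnusRB B).chiIter (tMul a) k)) (fun N => ?_) fun k => ?_
  · obtain ⟨M, hM⟩ := isLimit_chiIter a N
    refine ⟨M, fun m hm => ?_⟩
    rw [← map_sub]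
    exact map_mem_tAdic _ (hM m hm)
  · induction k with
    | zero =>
      refine hta.le.trans ?_
      rw [two_mul]
      exact le_self_add
    | succ k ih =>
      obtain ⟨hmem, hsum⟩ := chiIter_mem_and_isSum a k
      have hsum' := isSum_map (restrictHom B δ) hsum
      simp only [map_adTerm] at hsum'
      refine (ellOne_le_of_isSum
        (adTerm_mem_right (map_mem_tAdic _ (formalP_mem hmem))) hsum').trans ?_
      refine (tsum_ellOne_adTerm_le ?_ _).trans_eq (by rw [hta])
      refine le_trans ?_ h
      gcongr
      refine (ellOne_restrictHom_formalP_le hδ _).trans ?_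
      gcongr

/-! ### Solution of the initial value problem by iterated integrals -/

/-- The exponential of Magnus' expansion. -/
noncomputable def dysonSeries : PowerSeries C(ℝ, B) :=
  (tAdic ℝ C(ℝ, B)).exp (formalP (chiZero a))

theorem hasFormalDeriv_dysonSeries :
    HasFormalDeriv (dysonSeries a) (tMul a * dysonSeries a) :=
  (isMagnusExponent_formalP a).deriv_exp

/-- The integral form of the formal problem; its coefficients are the iterated integrals. -/
theorem dysonSeries_eq : dysonSeries a = 1 + formalP (tMul a * dysonSeries a) := by
  refine ext_of_deriv (hasFormalDeriv_dysonSeries a) (g := tMul a * dysonSeries a) ?_ ?_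
  · intro n x
    have h := (hasFormalDeriv_one (B := B) n x).add
      (hasFormalDeriv_formalP (tMul a * dysonSeries a) n x)
    have e : term (0 : PowerSeries C(ℝ, B)) n x = 0 := by simp [term]
    rw [e, zero_add] at h
    exact h
  · have h1 : evalAt 0 (dysonSeries a) = 1 := (isMagnusExponent_formalP a).initial_exp
    rw [h1, evalAt_eq_map, map_add, map_one, ← evalAt_eq_map, evalAt_zero_formalP, add_zero]

theorem term_dysonSeries_zero (x : ℝ) : term (dysonSeries a) 0 x = 1 := by
  rw [dysonSeries_eq, term, map_add, coeff_formalP, coeff_tMul_mul_zero, map_zero, add_zero,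
    PowerSeries.coeff_zero_one]
  rfl

theorem term_dysonSeries_succ (n : ℕ) (x : ℝ) :
    term (dysonSeries a) (n + 1) x = ∫ y in (0 : ℝ)..x, a y * term (dysonSeries a) n y := by
  have h : PowerSeries.coeff (n + 1) (dysonSeries a) =
      riemannP (a * PowerSeries.coeff n (dysonSeries a)) := by
    conv_lhs => rw [dysonSeries_eq]
    rw [map_add, coeff_formalP, coeff_tMul_mul_succ, PowerSeries.coeff_one,
      if_neg (Nat.succ_ne_zero n), zero_add]
  rw [term, h]
  rfl

theorem norm_term_dysonSeries_le {R M : ℝ} (hM : ∀ y ∈ Set.Icc (-R) R, ‖a y‖ ≤ M) (hM0 : 0 ≤ M)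
    (n : ℕ) {x : ℝ} (hx : x ∈ Set.Icc (-R) R) :
    ‖term (dysonSeries a) n x‖ ≤ ‖(1 : B)‖ * ((M * |x|) ^ n / n.factorial) := by
  induction n generalizing x with
  | zero => simp [term_dysonSeries_zero]
  | succ n ih =>
    have hsub : ∀ y ∈ Set.uIoc 0 x, y ∈ Set.Icc (-R) R := fun y hy =>
      Set.uIcc_subset_Icc (show (0 : ℝ) ∈ Set.Icc (-R) R from
        ⟨by linarith [hx.1, hx.2], by linarith [hx.1, hx.2]⟩) hx (Set.uIoc_subset_uIcc hy)
    rw [term_dysonSeries_succ]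
    refine intervalIntegral.norm_integral_le_integral_norm_uIoc.trans ?_
    have hcont : Continuous fun y => ‖a y * term (dysonSeries a) n y‖ :=
      (a.continuous.mul (PowerSeries.coeff n (dysonSeries a)).continuous).norm
    have hcont' : Continuous fun y : ℝ =>
      (M * ‖(1 : B)‖ * M ^ n / n.factorial) * |y - 0| ^ n := by fun_prop
    have hle : ∫ y in Set.uIoc 0 x, ‖a y * term (dysonSeries a) n y‖ ≤
        ∫ y in Set.uIoc 0 x, (M * ‖(1 : B)‖ * M ^ n / n.factorial) * |y - 0| ^ n := by
      refine MeasureTheory.setIntegral_mono_on (hcont.integrableOn_uIoc)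
        (hcont'.integrableOn_uIoc) measurableSet_uIoc fun y hy => ?_
      calc ‖a y * term (dysonSeries a) n y‖ ≤ ‖a y‖ * ‖term (dysonSeries a) n y‖ := norm_mul_le _ _
        _ ≤ M * (‖(1 : B)‖ * ((M * |y|) ^ n / n.factorial)) :=
          mul_le_mul (hM y (hsub y hy)) (ih (hsub y hy)) (norm_nonneg _) hM0
        _ = _ := by rw [sub_zero, mul_pow]; ring
    refine hle.trans_eq ?_
    rw [MeasureTheory.integral_const_mul, integral_pow_abs_sub_uIoc, sub_zero,
      Nat.factorial_succ, mul_pow]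
    have : (n.factorial : ℝ) ≠ 0 := Nat.cast_ne_zero.2 (Nat.factorial_ne_zero n)
    push_cast
    field_simp
    ring

omit [CompleteSpace B] in
theorem exists_norm_bound_Icc (R : ℝ) : ∃ M, 0 ≤ M ∧ ∀ y ∈ Set.Icc (-R) R, ‖a y‖ ≤ M :=
  ⟨‖restrictHom B R a‖, norm_nonneg _, fun _ hy => norm_apply_le_restrictHom hy a⟩

theorem summable_norm_term_dysonSeries (x : ℝ) :
    Summable fun n => ‖term (dysonSeries a) n x‖ := by
  obtain ⟨M, hM0, hM⟩ := exists_norm_bound_Icc a |x|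
  exact Summable.of_nonneg_of_le (fun _ => norm_nonneg _)
    (fun n => norm_term_dysonSeries_le a hM hM0 n ⟨neg_abs_le x, le_abs_self x⟩)
    ((Real.summable_pow_div_factorial _).mul_left _)

theorem solvesIVP_dysonSeries : SolvesIVP a (value (dysonSeries a)) where
  deriv x := by
    -- The interval is enlarged by 1 to make x an interior point. The majorant u of the termwise
    -- derivatives is shifted because ta · F has no constant coefficient.
    obtain ⟨M, hM0, hM⟩ := exists_norm_bound_Icc a (|x| + 1)
    let u : ℕ → ℝ := fun n => match n with
      | 0 => 0
      | n + 1 => M * (‖(1 : B)‖ * ((M * (|x| + 1)) ^ n / n.factorial))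
    have hu : Summable u := (summable_nat_add_iff 1).1
      (((Real.summable_pow_div_factorial (M * (|x| + 1))).mul_left _).mul_left M)
    have hx : x ∈ Set.Ioo (-(|x| + 1)) (|x| + 1) :=
      ⟨by linarith [neg_abs_le x], by linarith [le_abs_self x]⟩
    have hsucc : ∀ n y, term (tMul a * dysonSeries a) (n + 1) y =
        a y * term (dysonSeries a) n y := fun n y => by
      rw [term, coeff_tMul_mul_succ]; rfl
    have hzero : ∀ y, term (tMul a * dysonSeries a) 0 y = 0 := fun y => by
      rw [term, coeff_tMul_mul_zero]; rfl
    have hbound : ∀ n, ∀ y ∈ Set.Ioo (-(|x| + 1)) (|x| + 1),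
        ‖term (tMul a * dysonSeries a) n y‖ ≤ u n := by
      intro n y hy
      rcases n with _ | n
      · simp [hzero, u]
      · have hy' := Set.Ioo_subset_Icc_self hy
        rw [hsucc]
        refine (norm_mul_le _ _).trans (mul_le_mul (hM y hy') ?_ (norm_nonneg _) hM0)
        refine (norm_term_dysonSeries_le a hM hM0 n hy').trans ?_
        have := abs_le.2 hy'
        gcongr
    have h := hasDerivAt_tsum_of_isPreconnected hu isOpen_Ioo isPreconnected_Ioo
      (fun n y _ => hasFormalDeriv_dysonSeries a n y) hbound hx
      (summable_norm_term_dysonSeries a x).of_norm hx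
    have hs : Summable fun n => term (tMul a * dysonSeries a) n x :=
      Summable.of_norm_bounded hu fun n => hbound n x hx
    rw [hs.tsum_eq_zero_add, hzero, zero_add] at h
    simp only [hsucc] at h
    rwa [(summable_norm_term_dysonSeries a x).of_norm.tsum_mul_left] at h
  initial := by
    have h1 : evalAt 0 (dysonSeries a) = 1 := (isMagnusExponent_formalP a).initial_exp
    have e : ∀ n, term (dysonSeries a) n 0 = if n = 0 then 1 else 0 := fun n => by
      rw [← PowerSeries.coeff_one, ← h1, evalAt, PowerSeries.coeff_mk]
    rw [value, tsum_congr e, tsum_ite_eq]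

-- The equation is linear, hence Lipschitz with constant sup ‖a‖ on a bounded interval containing 0
-- and x.
omit [CompleteSpace B] in
theorem solvesIVP_unique {F G : ℝ → B} (hF : SolvesIVP a F) (hG : SolvesIVP a G) : G = F := by
  funext x
  obtain ⟨M, hM0, hM⟩ := exists_norm_bound_Icc a (|x| + 1)
  refine ODE_solution_unique_of_mem_Ioo (v := fun t y => a t * y) (s := fun _ => Set.univ)
    (K := ⟨M, hM0⟩) (a := -(|x| + 1)) (b := |x| + 1) (t₀ := 0) ?_
    ⟨by linarith [abs_nonneg x], by linarith [abs_nonneg x]⟩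
    (fun t _ => ⟨hG.deriv t, trivial⟩) (fun t _ => ⟨hF.deriv t, trivial⟩)
    (hG.initial.trans hF.initial.symm)
    ⟨by linarith [neg_abs_le x], by linarith [le_abs_self x]⟩
  intro t ht
  refine (LipschitzWith.of_dist_le_mul fun y z => ?_).lipschitzOnWith
  rw [dist_eq_norm, dist_eq_norm, ← mul_sub]
  exact (norm_mul_le _ _).trans
    (mul_le_mul_of_nonneg_right (hM t (Set.Ioo_subset_Icc_self ht)) (norm_nonneg _))

/-- Evaluation at x is an algebra homomorphism, so convergence at this one point suffices. -/
theorem value_dysonSeries {x : ℝ} (h : Summable fun n => ‖term (formalP (chiZero a)) n x‖) :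
    value (dysonSeries a) x = NormedSpace.exp (value (formalP (chiZero a)) x) := by
  have hmem := formalP_mem (chiZero_mem a)
  rw [value_eq_coeffSum, value_eq_coeffSum, dysonSeries, map_exp _ hmem,
    coeffSum_exp (map_mem_tAdic _ hmem) (summable_norm_term_iff.1 h)]

/-! ### Convergence near the origin -/

theorem continuousOn_value {δ : ℝ} {f : PowerSeries C(ℝ, B)}
    (h : ellOne (PowerSeries.map (restrictHom B δ : C(ℝ, B) →+* C(Set.Icc (-δ) δ, B)) f) ≠ ∞) :
    ContinuousOn (value f) (Set.Icc (-δ) δ) :=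
  continuousOn_tsum (fun n => (PowerSeries.coeff n f).continuous.continuousOn)
    (ellOne_ne_top_iff.1 h) fun n x hx => by
      rw [PowerSeries.coeff_map]
      exact norm_apply_le_restrictHom hx _

/-- Dominated convergence, with the sup norms on [-δ, δ] as constant majorants. -/
theorem value_formalP {δ x : ℝ} (hx : x ∈ Set.Icc (-δ) δ) {f : PowerSeries C(ℝ, B)}
    (h : ellOne (PowerSeries.map (restrictHom B δ : C(ℝ, B) →+* C(Set.Icc (-δ) δ, B)) f) ≠ ∞) :
    value (formalP f) x = ∫ y in (0 : ℝ)..x, value f y := by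
  have hsub : ∀ y ∈ Set.uIoc 0 x, y ∈ Set.Icc (-δ) δ := fun y hy =>
    Set.uIcc_subset_Icc (show (0 : ℝ) ∈ Set.Icc (-δ) δ from
      ⟨by linarith [hx.1, hx.2], by linarith [hx.1, hx.2]⟩) hx (Set.uIoc_subset_uIcc hy)
  have hsum := ellOne_ne_top_iff.1 h
  have hb : ∀ n, ∀ y ∈ Set.uIoc 0 x, ‖term f n y‖ ≤
      ‖PowerSeries.coeff n (PowerSeries.map (restrictHom B δ : C(ℝ, B) →+* C(Set.Icc (-δ) δ, B)) f)‖ :=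
    fun n y hy => by
      rw [PowerSeries.coeff_map]
      exact norm_apply_le_restrictHom (hsub y hy) _
  have key := intervalIntegral.hasSum_integral_of_dominated_convergence
    (μ := MeasureTheory.volume) (a := 0) (b := x) (F := fun n y => term f n y) (f := value f)
    (fun n _ => ‖PowerSeries.coeff n (PowerSeries.map (restrictHom B δ : C(ℝ, B) →+* C(Set.Icc (-δ) δ, B)) f)‖)
    (fun n => (PowerSeries.coeff n f).continuous.aestronglyMeasurable)
    (fun n => Filter.Eventually.of_forall (hb n))
    (Filter.Eventually.of_forall fun _ _ => hsum) intervalIntegrable_const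
    (Filter.Eventually.of_forall fun y hy =>
      (Summable.of_norm_bounded hsum fun n => hb n y hy).hasSum)
  rw [value, tsum_congr fun n => term_formalP f n x]
  exact key.tsum_eq

/-- This is the formal fixed-point equation, evaluated at x and then at t = 1. -/
theorem hasSum_adTerm_value {x : ℝ}
    (h : 2 * ellOne (PowerSeries.map (evalHom B x : C(ℝ, B) →+* B) (formalP (chiZero a))) ≤ 2⁻¹) :
    HasSum (adTerm ℝ (value (formalP (chiZero a)) x) (a x)) (value (chiZero a) x) := by
  have hmem := map_mem_tAdic (evalHom B x) (formalP_mem (chiZero_mem a))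
  have hta : PowerSeries.map (evalHom B x : C(ℝ, B) →+* B) (tMul a) =
      PowerSeries.monomial 1 (a x) := map_tMul _ _
  have hsum := isSum_map (evalHom B x) (isSum_chiZero a)
  simp only [map_adTerm, hta] at hsum
  have hw : ellOne (PowerSeries.monomial 1 (a x)) ≠ ∞ := by
    rw [ellOne_monomial]; exact enorm_ne_top
  have hu : ellOne (PowerSeries.map (evalHom B x : C(ℝ, B) →+* B) (formalP (chiZero a))) ≠ ∞ := by
    intro htop
    rw [htop] at h
    simp at h
  have key := hasSum_coeffSum_of_isSum (adTerm_mem_right hmem) hsum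
    (ne_top_of_le_ne_top (ENNReal.mul_ne_top ENNReal.ofNat_ne_top hw)
      (tsum_ellOne_adTerm_le h _))
  simp only [coeffSum_adTerm hu hw, coeffSum_monomial] at key
  rwa [← value_eq_coeffSum, ← value_eq_coeffSum] at key

omit [CompleteSpace B] in
theorem exists_radius : ∃ δ > 0,
    2 * (ENNReal.ofReal δ * (2 * ‖restrictHom B δ a‖ₑ)) ≤ 2⁻¹ := by
  have hpos : 0 < 8 * (‖restrictHom B 1 a‖ + 1) := by positivity
  -- The norm on [-δ, δ] depends on δ, so it is bounded by the norm M on [-1, 1]; then 4δ(M+1) =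
  -- 1/2, and M+1 avoids dividing by zero.
  refine ⟨(8 * (‖restrictHom B 1 a‖ + 1))⁻¹, inv_pos.2 hpos, ?_⟩
  set M := ‖restrictHom B 1 a‖ with hMdef
  have hM0 : 0 ≤ M := norm_nonneg _
  set δ := (8 * (M + 1))⁻¹ with hδ
  have hδ0 : 0 < δ := inv_pos.2 hpos
  have hδ1 : δ ≤ 1 := inv_le_one_of_one_le₀ (by linarith)
  have hle : ‖restrictHom B δ a‖ ≤ M := by
    refine (ContinuousMap.norm_le _ hM0).2 ?_
    rintro ⟨x, hx⟩
    exact norm_apply_le_restrictHom (B := B) ⟨by linarith [hx.1], hx.2.trans hδ1⟩ a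
  have hreal : 2 * (δ * (2 * ‖restrictHom B δ a‖)) ≤ 2⁻¹ := by
    calc 2 * (δ * (2 * ‖restrictHom B δ a‖)) ≤ 2 * (δ * (2 * (M + 1))) := by gcongr; linarith
      _ = 2⁻¹ := by
        have : M + 1 ≠ 0 := by positivity
        rw [hδ]
        field_simp
        norm_num
  have := ENNReal.ofReal_le_ofReal hreal
  rwa [ENNReal.ofReal_mul (by norm_num), ENNReal.ofReal_mul hδ0.le,
    ENNReal.ofReal_mul (by norm_num), ofReal_norm,
    ENNReal.ofReal_inv_of_pos (x := 2) (by norm_num),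
    ENNReal.ofReal_ofNat] at this

end InitialValueProblem

end MagnusBCH

open MagnusBCH in
theorem mainTheorem11 {B : Type*} [NormedRing B] [NormedAlgebra ℝ B] [CompleteSpace B]
    (a : C(ℝ, B)) :
    -- the weight zero BCH-recursion converges to its only solution `χ₀(t a)` in `A₁`
    (chiZero a ∈ (magnusRB B).filt 1 ∧
      (magnusRB B).IsLimit ((magnusRB B).chiIter (tMul a)) (chiZero a) ∧
      ∀ c ∈ (magnusRB B).filt 1,
        ((magnusRB B).IsSum (adTerm ℝ (formalP c) (tMul a)) c ↔ c = chiZero a)) ∧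
    -- Magnus' expansion, ordered by the number of factors `a`, is `P(χ₀(t a))`
    (∀ Ω : PowerSeries C(ℝ, B), IsMagnusExponent a Ω ↔ Ω = formalP (chiZero a)) ∧
    (∀ Ω : PowerSeries C(ℝ, B), SatisfiesMagnusRecursion a Ω ↔ Ω = formalP (chiZero a)) ∧
    -- the actual initial value problem, at `t = 1`
    ∃ F : ℝ → B, SolvesIVP a F ∧ (∀ G : ℝ → B, SolvesIVP a G → G = F) ∧
      (∀ x : ℝ, (Summable fun n => ‖term (formalP (chiZero a)) n x‖) →
        F x = NormedSpace.exp (value (formalP (chiZero a)) x)) ∧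
      ∃ δ > 0, ContinuousOn (value (chiZero a)) (Set.Ioo (-δ) δ) ∧
        ∀ x ∈ Set.Ioo (-δ) δ,
          (Summable fun n => ‖term (formalP (chiZero a)) n x‖) ∧
          (Summable fun n => ‖term (chiZero a) n x‖) ∧
          value (formalP (chiZero a)) x = ∫ y in (0 : ℝ)..x, value (chiZero a) y ∧
          HasSum (adTerm ℝ (∫ y in (0 : ℝ)..x, value (chiZero a) y) (a x))
            (value (chiZero a) x) := by
  -- F is the Dyson sum, which converges on all of ℝ without any convergence assumption on the
  -- Magnus series.
  refine ⟨⟨chiZero_mem a, isLimit_chiIter a, fun c hc => isSum_adTerm_formalP_iff a hc⟩,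
    isMagnusExponent_iff a, satisfiesMagnusRecursion_iff a, value (dysonSeries a),
    solvesIVP_dysonSeries a, fun G hG => solvesIVP_unique a (solvesIVP_dysonSeries a) hG,
    fun x hx => value_dysonSeries a hx, ?_⟩
  obtain ⟨δ, hδ, hsmall⟩ := exists_radius a
  have hchi := ellOne_restrictHom_chiZero_le a hδ.le hsmall
  have hfin := ne_top_of_le_ne_top (ENNReal.mul_ne_top ENNReal.ofNat_ne_top enorm_ne_top) hchi
  refine ⟨δ, hδ, (continuousOn_value hfin).mono Set.Ioo_subset_Icc_self, fun x hx => ?_⟩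
  have hx' := Set.Ioo_subset_Icc_self hx
  have hΩ : 2 * ellOne (PowerSeries.map (evalHom B x : C(ℝ, B) →+* B) (formalP (chiZero a))) ≤
      2⁻¹ := by
    refine le_trans ?_ hsmall
    gcongr
    refine (ellOne_evalHom_le hx' _).trans ((ellOne_restrictHom_formalP_le hδ.le _).trans ?_)
    gcongr
  have hΩfin : ellOne (PowerSeries.map (evalHom B x : C(ℝ, B) →+* B) (formalP (chiZero a))) ≠
      ⊤ := by
    intro htop
    rw [htop] at hΩ
    simp at hΩ
  have hint := value_formalP hx' hfin
  refine ⟨summable_norm_term_iff.2 hΩfin,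
    summable_norm_term_iff.2 (ne_top_of_le_ne_top hfin (ellOne_evalHom_le hx' _)), hint, ?_⟩
  rw [← hint]
  exact hasSum_adTerm_value a hΩ
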